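/- Let $k$ be an algebraically closed field of characteristic $2$ and let $G=C_2\times C_2=\langle g_1,g_2\rangle$ be the Klein four group. Given a representation $X$ of the Kronecker quiver, that is, a pair of linear maps $X_{\alpha_1},X_{\alpha_2}\colon X_1\to X_2$ between $k$-vector spaces, let $TX$ be the representation of $G$ on $X_1\oplus X_2$ in which $g_i$ acts as $\mathrm{id}+\begin{pmatrix}0&0\\ X_{\alpha_i}&0\end{pmatrix}$ for $i=1,2$. Consider the following Kronecker representations, written $(X_{\alpha_1},X_{\alpha_2})$. - $P_r\colon k^r\rightrightarrows k^{r+1}$ given by $\left(\begin{pmatrix}\mathrm{id}\\0\end{pmatrix},\begin{pmatrix}0\\\mathrm{id}\end{pmatrix}\right)$, where $\mathrm{id}=\mathrm{id}_{k^r}$. - $I_r\colon k^{r+1}\rightrightarrows k^{r}$ given by $\left(\begin{pmatrix}\mathrm{id}&0\end{pmatrix},\begin{pmatrix}0&\mathrm{id}\end{pmatrix}\right)$, where $\mathrm{id}=\mathrm{id}_{k^r}$. - For $p\ge 1$ and $\lambda\in\mathbb P^1(k)$, $R_{p,\lambda}\colon k^p\rightrightarrows k^p$ given by $(J(p,\lambda_0),\mathrm{id})$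 if $\lambda=(\lambda_0:1)$ and by $(\mathrm{id},J(p,0))$ if $\lambda=(1:0)$, where $J(p,\mu)$ is the Jordan block of size $p$ with eigenvalue $\mu$, sending $e_i$ to $\mu e_i+e_{i-1}$ (with $e_0=0$). Then the representations $$k[G],\qquad TP_r\ (r\ge 1),\qquad TI_r\ (r\ge 0),\qquad TR_{p,\lambda}\ (p\ge 1,\ \lambda\in\mathbb P^1(k))$$ form, up to isomorphism, a complete list of the finite-dimensional indecomposable $k$-linear representations of $G$: each of them is finite-dimensional and indecomposable, every finite-dimensional indecomposable representation of $G$ over $k$ is isomorphic to one of them, and no two of them with different labels are isomorphic. Here $k[G]$ is the regular representation, and a representation $X$ is indecomposable if $X\ne 0$ and $X=X'\oplus X''$ with subrepresentations $X',X''$ implies $X'=0$ or $X''=0$. -/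

import Mathlib

universe u v w

/-- The Klein four group `C₂ × C₂`. -/
abbrev KleinFour : Type := Multiplicative (ZMod 2) × Multiplicative (ZMod 2)

namespace KleinFour

/-- The generator of the first factor. -/
def g₁ : KleinFour := (Multiplicative.ofAdd 1, 1)

/-- The generator of the second factor. -/
def g₂ : KleinFour := (1, Multiplicative.ofAdd 1)

end KleinFour

/-- A representation is indecomposable if it is non-zero and `X = U ⊕ W` with
subrepresentations `U`, `W` forces `U = 0` or `W = 0`. -/
def Representation.IsIndecomposable {k : Type u} {G : Type v} {V : Type w} [Field k] [Group G]
    [AddCommGroup V] [Module k V] (ρ : Representation k G V) : Prop :=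
  Nontrivial V ∧ ∀ U W : Subrepresentation ρ, IsCompl U W → U = ⊥ ∨ W = ⊥

section LoopRepresentation

variable {k : Type u} {M : Type v} [Field k] [AddCommGroup M] [Module k M]

theorem one_add_sq_eq_one_of_sq_eq_zero [CharP k 2] {A : Module.End k M} (hA : A ^ 2 = 0) :
    (1 + A) ^ 2 = 1 := by
  have h2 : (2 : k) = 0 := by exact_mod_cast CharP.cast_eq_zero k 2
  have h : A + A = 0 := by rw [← two_smul k A, h2, zero_smul]
  have : (1 + A) ^ 2 = 1 + (A + A) + A ^ 2 := by noncomm_ring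
  rw [this, h, hA, add_zero, add_zero]

theorem pow_val_add_of_sq_eq_one {R : Type v} [Monoid R] {a : R} (ha : a ^ 2 = 1) (x y : ZMod 2) :
    a ^ (x + y).val = a ^ x.val * a ^ y.val := by
  rw [ZMod.val_add, ← pow_add, ← pow_mod_orderOf a ((x.val + y.val) % 2),
    Nat.mod_mod_of_dvd _ (orderOf_dvd_of_pow_eq_one ha), pow_mod_orderOf]

/-- The representation of the Klein four group over a field of characteristic two that is given
by two commuting endomorphisms `A`, `B` of square zero: the group element `g₁` acts as `1 + A`
and the group element `g₂` acts as `1 + B`. -/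
def loopRepresentation [CharP k 2] (A B : Module.End k M) (hAB : Commute A B)
    (hA : A ^ 2 = 0) (hB : B ^ 2 = 0) : Representation k KleinFour M where
  toFun g := (1 + A) ^ (g.1.toAdd).val * (1 + B) ^ (g.2.toAdd).val
  map_one' := by simp
  map_mul' g h := by
    have hc : Commute (1 + A) (1 + B) :=
      (Commute.one_left _).add_left ((Commute.one_right _).add_right hAB)
    simp only [Prod.fst_mul, Prod.snd_mul, toAdd_mul,
      pow_val_add_of_sq_eq_one (one_add_sq_eq_one_of_sq_eq_zero hA),
      pow_val_add_of_sq_eq_one (one_add_sq_eq_one_of_sq_eq_zero hB)]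
    exact (hc.pow_pow _ _).symm.mul_mul_mul_comm _ _ |>.symm

theorem loopRepresentation_g₁ [CharP k 2] (A B : Module.End k M) (hAB : Commute A B)
    (hA : A ^ 2 = 0) (hB : B ^ 2 = 0) :
    loopRepresentation A B hAB hA hB KleinFour.g₁ = 1 + A := by
  simp [loopRepresentation, KleinFour.g₁, ZMod.val_one]

theorem loopRepresentation_g₂ [CharP k 2] (A B : Module.End k M) (hAB : Commute A B)
    (hA : A ^ 2 = 0) (hB : B ^ 2 = 0) :
    loopRepresentation A B hAB hA hB KleinFour.g₂ = 1 + B := by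
  simp [loopRepresentation, KleinFour.g₂, ZMod.val_one]

end LoopRepresentation

/-- A representation of the Kronecker quiver with two vertices `1`, `2` and two arrows
`α₁, α₂ : 1 → 2`, on the vector spaces `V` (at `1`) and `W` (at `2`). -/
structure KroneckerRep (k : Type u) (V : Type v) (W : Type w) [Field k]
    [AddCommGroup V] [Module k V] [AddCommGroup W] [Module k W] where
  α₁ : V →ₗ[k] W
  α₂ : V →ₗ[k] W

section BlockMap

variable {k : Type u} {V : Type v} {W : Type w} [Field k]
  [AddCommGroup V] [Module k V] [AddCommGroup W] [Module k W]

/-- The endomorphism of `V ⊕ W` with block matrix `(0 0; a 0)`, that is `(v, w) ↦ (0, a v)`. -/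
def lowerBlock (a : V →ₗ[k] W) : Module.End k (V × W) :=
  LinearMap.inr k V W ∘ₗ a ∘ₗ LinearMap.fst k V W

theorem lowerBlock_mul (a b : V →ₗ[k] W) : lowerBlock a * lowerBlock b = 0 := by
  ext <;> simp [lowerBlock]

/-- The object map of the functor `T` from Kronecker representations to representations of the
Klein four group in characteristic two: `TX = X₁ ⊕ X₂`, where `gᵢ - 1` acts as
`(0 0; X_{αᵢ} 0)`. -/
def KroneckerRep.T [CharP k 2] (X : KroneckerRep k V W) : Representation k KleinFour (V × W) :=
  loopRepresentation (lowerBlock X.α₁) (lowerBlock X.α₂)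
    (by rw [commute_iff_eq, lowerBlock_mul, lowerBlock_mul])
    (by rw [sq, lowerBlock_mul]) (by rw [sq, lowerBlock_mul])

end BlockMap

/-- The Jordan block of size `p` with eigenvalue `μ`, sending `e_i` to `μ e_i + e_{i-1}`. -/
def jordanBlock {k : Type u} [Field k] (p : ℕ) (μ : k) : Matrix (Fin p) (Fin p) k :=
  Matrix.of fun i j => if i = j then μ else if (j : ℕ) = i + 1 then 1 else 0

namespace KroneckerRep

variable (k : Type u) [Field k]

/-- The preprojective representation `P_r : k^r ⇉ k^{r+1}` with the block matrices
`(id; 0)` and `(0; id)`. -/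
noncomputable def P (r : ℕ) : KroneckerRep k (Fin r → k) (Fin (r + 1) → k) where
  α₁ := Matrix.toLin' (Matrix.of fun i j => if i = j.castSucc then 1 else 0)
  α₂ := Matrix.toLin' (Matrix.of fun i j => if i = j.succ then 1 else 0)

/-- The preinjective representation `I_r : k^{r+1} ⇉ k^r` with the block matrices
`(id 0)` and `(0 id)`. -/
noncomputable def I (r : ℕ) : KroneckerRep k (Fin (r + 1) → k) (Fin r → k) where
  α₁ := Matrix.toLin' (Matrix.of fun i j => if j = i.castSucc then 1 else 0)
  α₂ := Matrix.toLin' (Matrix.of fun i j => if j = i.succ then 1 else 0)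

variable {k}

open Classical in
/-- The regular representation `R_{p,λ} : k^p ⇉ k^p` for a point `λ` of the projective line:
it is `(J(p, λ₀), id)` for `λ = (λ₀ : 1)`, and `(id, J(p, 0))` for `λ = (1 : 0)`.
For `λ = (1 : λ₁)` with `λ₁ ≠ 0` one could equally well take `(id, J(p, λ₁))`, which is
isomorphic to `(J(p, λ₁⁻¹), id)`. -/
noncomputable def R (p : ℕ) (l : Projectivization k (Fin 2 → k)) :
    KroneckerRep k (Fin p → k) (Fin p → k) :=
  if l.rep 1 = 0 then
    { α₁ := LinearMap.id
      α₂ := Matrix.toLin' (jordanBlock p 0) }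
  else
    { α₁ := Matrix.toLin' (jordanBlock p (l.rep 0 / l.rep 1))
      α₂ := LinearMap.id }

theorem R_affine (p : ℕ) (μ : k) (h : ![μ, 1] ≠ 0) :
    R p (Projectivization.mk k ![μ, 1] h) =
      { α₁ := Matrix.toLin' (jordanBlock p μ), α₂ := LinearMap.id } := by
  obtain ⟨a, ha⟩ := Projectivization.exists_smul_eq_mk_rep k ![μ, 1] h
  have h0 : (Projectivization.mk k ![μ, 1] h).rep 0 = a * μ := by
    rw [← ha]; simp [Units.smul_def]
  have h1 : (Projectivization.mk k ![μ, 1] h).rep 1 = a := by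
    rw [← ha]; simp [Units.smul_def]
  rw [R, h0, h1, if_neg a.ne_zero, mul_div_cancel_left₀ _ a.ne_zero]

theorem R_infinity (p : ℕ) (h : ![(1 : k), 0] ≠ 0) :
    R p (Projectivization.mk k ![1, 0] h) =
      { α₁ := LinearMap.id, α₂ := Matrix.toLin' (jordanBlock p 0) } := by
  obtain ⟨a, ha⟩ := Projectivization.exists_smul_eq_mk_rep k ![(1 : k), 0] h
  have h1 : (Projectivization.mk k ![(1 : k), 0] h).rep 1 = 0 := by
    rw [← ha]; simp
  rw [R, if_pos h1]

end KroneckerRep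

/-- The index set of the list: one index for `k[G]`, one for each `TP_r` with `r ≥ 1`, one for
each `TI_r` with `r ≥ 0`, and one for each `TR_{p,λ}` with `p ≥ 1` and `λ ∈ ℙ¹(k)`. -/
inductive KleinIndex (k : Type u) [Field k] : Type u
  | regular : KleinIndex k
  | preprojective (r : ℕ) (hr : 1 ≤ r) : KleinIndex k
  | preinjective (r : ℕ) : KleinIndex k
  | tube (p : ℕ) (hp : 1 ≤ p) (l : Projectivization k (Fin 2 → k)) : KleinIndex k

/-- The representations of the Klein four group in the list. -/
noncomputable def kleinRep {k : Type u} [Field k] [CharP k 2] : KleinIndex k → Rep.{u} k KleinFour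
  | .regular => Rep.leftRegular k KleinFour
  | .preprojective r _ => Rep.of (KroneckerRep.P k r).T
  | .preinjective r => Rep.of (KroneckerRep.I k r).T
  | .tube p _ l => Rep.of (KroneckerRep.R p l).T

/-!
The norm element of `G` acts on a representation `ρ` as `(g₁ - 1) (g₂ - 1)`. Suppose it does not
kill `v`. The orbit map `k[G] → ρ`, `1 ↦ v` is injective, because the invariants of `k[G]` are
spanned by the norm element and every non-zero subrepresentation of a `2`-group in characteristic
`2` contains a non-zero invariant; it splits because `k[G]` is self-injective. So `k[G]` is the only
indecomposable representation on which the norm element acts non-trivially.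

If the norm element acts as zero, then `ρ` is of the form `TX`. A homomorphism `TX → TY` is block
triangular as soon as the maps of `X` jointly span its second space, and its diagonal blocks form a
morphism `X → Y`. On such `X`, therefore, `T` preserves indecomposability and reflects isomorphism,
which reduces everything to the classification of Kronecker representations.

There, if the pencil `α₂ - t α₁` has a kernel over `k[t]`, a kernel vector of minimal degree gives a
chain spanning a direct summand `I_r`; dually one finds a summand `P_r`. If neither the pencil nor
its dual has such a kernel, then some `α₂ - t α₁` is bijective and `X` is determined by a single
indecomposable endomorphism, that is, by a Jordan block. The parameter `λ` is recovered as the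
point of the projective line at which the pencil degenerates.
-/

section Idempotent

open Representation

variable {k G V W : Type*} [Field k] [Group G] [AddCommGroup V] [Module k V] [AddCommGroup W]
  [Module k W] {ρ : Representation k G V} {σ : Representation k G W}

theorem isCompl_toSubmodule_iff {U U' : Subrepresentation ρ} :
    IsCompl U.toSubmodule U'.toSubmodule ↔ IsCompl U U' := by
  simp only [isCompl_iff, disjoint_iff, codisjoint_iff, ← Subrepresentation.toSubmodule_inf,
    ← Subrepresentation.toSubmodule_sup,
    ← Subrepresentation.toSubmodule_injective.eq_iff (a := U ⊓ U'),
    ← Subrepresentation.toSubmodule_injective.eq_iff (a := U ⊔ U')]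
  rfl

theorem isIndecomposable_iff_forall_idempotent :
    ρ.IsIndecomposable ↔
      Nontrivial V ∧ ∀ p : ρ.IntertwiningMap ρ, p.comp p = p → p = 0 ∨ p = .id ρ := by
  refine and_congr_right fun _ => ⟨fun h p hp => ?_, fun h U U' hU => ?_⟩
  · have hp' : IsIdempotentElem p.toLinearMap := congr(($hp).toLinearMap)
    have hc : IsCompl (IntertwiningMap.range ρ ρ p) (IntertwiningMap.ker ρ ρ p) :=
      isCompl_toSubmodule_iff.1 (LinearMap.IsIdempotentElem.isCompl hp')
    refine (h _ _ hc).imp (fun hr => ?_) fun hk => ?_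
    · exact IntertwiningMap.ext (LinearMap.range_eq_bot.1 congr(($hr).toSubmodule))
    · have hinj : Function.Injective p := LinearMap.ker_eq_bot.1 congr(($hk).toSubmodule)
      exact IntertwiningMap.ext (LinearMap.ext fun v => hinj (congr($hp v)))
  · have hc := isCompl_toSubmodule_iff.2 hU
    set π := U.toSubmodule.projection U'.toSubmodule hc with hπ
    have hcomm (g : G) : Commute π (ρ g) := by
      refine (LinearMap.IsIdempotentElem.commute_iff
        (Submodule.isIdempotentElem_projection hc)).2 ⟨?_, ?_⟩
      · rw [Submodule.range_projection]
        exact fun v hv => U.apply_mem_toSubmodule g hv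
      · rw [Submodule.ker_projection]
        exact fun v hv => U'.apply_mem_toSubmodule g hv
    let p : ρ.IntertwiningMap ρ := ⟨π, fun g => hcomm g⟩
    refine (h p (IntertwiningMap.ext (Submodule.isIdempotentElem_projection hc))).imp
      (fun h0 => ?_) fun h1 => ?_
    · have : π = 0 := congr(($h0).toLinearMap)
      apply Subrepresentation.toSubmodule_injective
      rw [← Submodule.range_projection hc, ← hπ, this]
      exact LinearMap.range_zero
    · have : π = LinearMap.id := congr(($h1).toLinearMap)
      apply Subrepresentation.toSubmodule_injective
      rw [← Submodule.ker_projection hc, ← hπ, this]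
      exact LinearMap.ker_id

theorem nonempty_equiv_of_bijective_comp [Nontrivial W] (hρ : ρ.IsIndecomposable)
    (s : σ.IntertwiningMap ρ) (r : ρ.IntertwiningMap σ) (h : Function.Bijective (r.comp s)) :
    Nonempty (ρ.Equiv σ) := by
  let u := IntertwiningMap.ofBijective (r.comp s) h
  have hu (w : W) : u.symm (r (s w)) = w := u.symm_apply_apply w
  rcases (isIndecomposable_iff_forall_idempotent.1 hρ).2 (s.comp (u.symm.toIntertwiningMap.comp r))
    (by ext v; exact congr(s $(hu _))) with h0 | h1
  · obtain ⟨w, hw⟩ := exists_ne (0 : W)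
    have hsw : s w = 0 := congr(s $(hu w)).symm.trans congr($h0 (s w))
    exact absurd ((hu w).symm.trans (by rw [hsw, map_zero, map_zero])) hw
  · exact ⟨(IntertwiningMap.ofBijective s ⟨.of_comp (f := r) h.1, fun v => ⟨_, congr($h1 v)⟩⟩).symm⟩

theorem isIndecomposable_of_equiv (e : ρ.Equiv σ) (hρ : ρ.IsIndecomposable) :
    σ.IsIndecomposable := by
  have := hρ.1
  refine isIndecomposable_iff_forall_idempotent.2
    ⟨e.toLinearEquiv.symm.toEquiv.nontrivial, fun p hp => ?_⟩
  let q : ρ.IntertwiningMap ρ := e.symm.toIntertwiningMap.comp (p.comp e.toIntertwiningMap)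
  have hq (v : V) : e (q v) = p (e v) := e.apply_symm_apply _
  have hqq : q.comp q = q := by
    ext v
    exact e.toLinearEquiv.injective (((hq _).trans congr(p $(hq v))).trans
      (congr($hp (e v)).trans (hq v).symm))
  refine ((isIndecomposable_iff_forall_idempotent.1 hρ).2 q hqq).imp (fun h => ?_) fun h => ?_
  · ext w
    have := hq (e.symm w)
    rw [h, e.apply_symm_apply] at this
    exact this.symm.trans (map_zero e.toLinearEquiv)
  · ext w
    have := hq (e.symm w)
    rw [h, e.apply_symm_apply] at this
    exact this.symm.trans (e.apply_symm_apply w)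

end Idempotent

namespace KroneckerRep

section Hom

variable {k V W V' W' V'' W'' : Type*} [Field k] [AddCommGroup V] [Module k V] [AddCommGroup W]
  [Module k W] [AddCommGroup V'] [Module k V'] [AddCommGroup W'] [Module k W'] [AddCommGroup V'']
  [Module k V''] [AddCommGroup W''] [Module k W'']

/-- A morphism of representations of the Kronecker quiver. -/
@[ext]
structure Hom (X : KroneckerRep k V W) (Y : KroneckerRep k V' W') where
  fst : V →ₗ[k] V'
  snd : W →ₗ[k] W'
  snd_α₁ : ∀ v, snd (X.α₁ v) = Y.α₁ (fst v)
  snd_α₂ : ∀ v, snd (X.α₂ v) = Y.α₂ (fst v)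

/-- An isomorphism of representations of the Kronecker quiver. -/
structure Iso (X : KroneckerRep k V W) (Y : KroneckerRep k V' W') where
  fst : V ≃ₗ[k] V'
  snd : W ≃ₗ[k] W'
  snd_α₁ : ∀ v, snd (X.α₁ v) = Y.α₁ (fst v)
  snd_α₂ : ∀ v, snd (X.α₂ v) = Y.α₂ (fst v)

variable {X : KroneckerRep k V W} {Y : KroneckerRep k V' W'} {Z : KroneckerRep k V'' W''}

namespace Hom

instance : Zero (X.Hom Y) := ⟨⟨0, 0, by simp, by simp⟩⟩

@[simp]
theorem zero_fst : (0 : X.Hom Y).fst = 0 := rfl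

@[simp]
theorem zero_snd : (0 : X.Hom Y).snd = 0 := rfl

variable (X) in
/-- The identity morphism. -/
@[simps]
def id : X.Hom X := ⟨.id, .id, fun _ => rfl, fun _ => rfl⟩

/-- The composition `g ∘ f`. -/
@[simps]
def comp (g : Y.Hom Z) (f : X.Hom Y) : X.Hom Z where
  fst := g.fst ∘ₗ f.fst
  snd := g.snd ∘ₗ f.snd
  snd_α₁ v := by simp [f.snd_α₁, g.snd_α₁]
  snd_α₂ v := by simp [f.snd_α₂, g.snd_α₂]

/-- A morphism with bijective components, as an isomorphism. -/
noncomputable def toIso (f : X.Hom Y) (h₁ : Function.Bijective f.fst)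
    (h₂ : Function.Bijective f.snd) : X.Iso Y :=
  ⟨.ofBijective f.fst h₁, .ofBijective f.snd h₂, f.snd_α₁, f.snd_α₂⟩

end Hom

namespace Iso

/-- The morphism underlying an isomorphism. -/
@[simps]
def toHom (e : X.Iso Y) : X.Hom Y := ⟨e.fst, e.snd, e.snd_α₁, e.snd_α₂⟩

/-- The inverse isomorphism. -/
@[simps]
def symm (e : X.Iso Y) : Y.Iso X where
  fst := e.fst.symm
  snd := e.snd.symm
  snd_α₁ v := by rw [LinearEquiv.symm_apply_eq, e.snd_α₁, LinearEquiv.apply_symm_apply]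
  snd_α₂ v := by rw [LinearEquiv.symm_apply_eq, e.snd_α₂, LinearEquiv.apply_symm_apply]

/-- The composition of two isomorphisms. -/
def trans (e : X.Iso Y) (e' : Y.Iso Z) : X.Iso Z where
  fst := e.fst.trans e'.fst
  snd := e.snd.trans e'.snd
  snd_α₁ v := by simp [e.snd_α₁, e'.snd_α₁]
  snd_α₂ v := by simp [e.snd_α₂, e'.snd_α₂]

end Iso

/-- A representation of the Kronecker quiver is indecomposable if it is non-zero and `0` and `1` are
the only idempotents of its endomorphism ring. -/
def IsIndecomposable (X : KroneckerRep k V W) : Prop :=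
  Nontrivial (V × W) ∧ ∀ f : X.Hom X, f.comp f = f → f = 0 ∨ f = .id X

theorem nonempty_iso_of_bijective_comp [Nontrivial (V' × W')] (hX : X.IsIndecomposable)
    (s : Y.Hom X) (r : X.Hom Y) (h₁ : Function.Bijective (r.comp s).fst)
    (h₂ : Function.Bijective (r.comp s).snd) : Nonempty (X.Iso Y) := by
  let u := (r.comp s).toIso h₁ h₂
  have hu₁ (v : V') : u.fst.symm (r.fst (s.fst v)) = v := u.fst.symm_apply_apply v
  have hu₂ (w : W') : u.snd.symm (r.snd (s.snd w)) = w := u.snd.symm_apply_apply w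
  rcases hX.2 (s.comp (u.symm.toHom.comp r))
    (by ext v; exacts [congr(s.fst $(hu₁ _)), congr(s.snd $(hu₂ _))]) with h0 | h1
  · obtain ⟨⟨v, w⟩, hvw⟩ := exists_ne (0 : V' × W')
    have hv : s.fst v = 0 := congr(s.fst $(hu₁ v)).symm.trans congr(($h0).fst (s.fst v))
    have hw : s.snd w = 0 := congr(s.snd $(hu₂ w)).symm.trans congr(($h0).snd (s.snd w))
    refine absurd (Prod.ext ((hu₁ v).symm.trans ?_) ((hu₂ w).symm.trans ?_)) hvw
    · rw [hv, map_zero, map_zero, Prod.fst_zero]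
    · rw [hw, map_zero, map_zero, Prod.snd_zero]
  · exact ⟨(s.toIso ⟨.of_comp (f := r.fst) h₁.1, fun v => ⟨_, congr(($h1).fst v)⟩⟩
      ⟨.of_comp (f := r.snd) h₂.1, fun w => ⟨_, congr(($h1).snd w)⟩⟩).symm⟩

theorem Iso.isIndecomposable (e : X.Iso Y) (hX : X.IsIndecomposable) : Y.IsIndecomposable := by
  have := hX.1
  refine ⟨(e.fst.prodCongr e.snd).symm.toEquiv.nontrivial, fun f hf => ?_⟩
  have hf₁ (v : V') : f.fst (f.fst v) = f.fst v := congr(($hf).fst v)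
  have hf₂ (w : W') : f.snd (f.snd w) = f.snd w := congr(($hf).snd w)
  refine (hX.2 (e.symm.toHom.comp (f.comp e.toHom)) (by ext v <;> simp [hf₁, hf₂])).imp
    (fun h0 => ?_) fun h1 => ?_
  · ext v
    · simpa using congr(e.fst (($h0).fst (e.fst.symm v)))
    · simpa using congr(e.snd (($h0).snd (e.snd.symm v)))
  · ext v
    · simpa using congr(e.fst (($h1).fst (e.fst.symm v)))
    · simpa using congr(e.snd (($h1).snd (e.snd.symm v)))

end Hom

section Dual

open Module

variable {k V W V' W' : Type*} [Field k] [AddCommGroup V] [Module k V] [AddCommGroup W]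
  [Module k W] [AddCommGroup V'] [Module k V'] [AddCommGroup W'] [Module k W']

/-- The dual `W* ⇉ V*` of the representation `V ⇉ W`. -/
@[simps]
def dual (X : KroneckerRep k V W) : KroneckerRep k (Dual k W) (Dual k V) :=
  ⟨X.α₁.dualMap, X.α₂.dualMap⟩

variable {X : KroneckerRep k V W} {Y : KroneckerRep k V' W'}

/-- The transpose of a morphism. -/
@[simps]
def Hom.dual (f : X.Hom Y) : Y.dual.Hom X.dual where
  fst := f.snd.dualMap
  snd := f.fst.dualMap
  snd_α₁ g := by ext v; simp [f.snd_α₁]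
  snd_α₂ g := by ext v; simp [f.snd_α₂]

/-- The transpose of an isomorphism. -/
def Iso.dual (e : X.Iso Y) : Y.dual.Iso X.dual where
  fst := e.snd.dualMap
  snd := e.fst.dualMap
  snd_α₁ g := by ext v; simp [e.snd_α₁]
  snd_α₂ g := by ext v; simp [e.snd_α₂]

variable (X) in
/-- The evaluation isomorphism from a finite-dimensional representation to its bidual. -/
noncomputable def evalIso [FiniteDimensional k V] [FiniteDimensional k W] : X.Iso X.dual.dual where
  fst := evalEquiv k V
  snd := evalEquiv k W
  snd_α₁ _ := rfl
  snd_α₂ _ := rfl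

theorem dual_injective : Function.Injective (Hom.dual : X.Hom Y → Y.dual.Hom X.dual) := by
  intro f g h
  ext v
  · exact eval_apply_injective k (LinearMap.ext fun φ => congr(($h).snd φ v))
  · exact eval_apply_injective k (LinearMap.ext fun φ => congr(($h).fst φ v))

theorem isIndecomposable_of_dual (hX : X.dual.IsIndecomposable) : X.IsIndecomposable := by
  have := hX.1
  refine ⟨not_subsingleton_iff_nontrivial.1 fun hs => not_subsingleton (Dual k W × Dual k V) ?_,
    fun f hf => (hX.2 f.dual congr(($hf).dual)).imp (fun h => dual_injective ?_)
      fun h => dual_injective ?_⟩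
  · have : Subsingleton V := (Prod.fst_surjective (β := W)).subsingleton
    have : Subsingleton W := (Prod.snd_surjective (α := V)).subsingleton
    infer_instance
  · exact h.trans (by ext <;> simp)
  · exact h.trans (by ext <;> simp)

theorem isIndecomposable_dual_iff [FiniteDimensional k V] [FiniteDimensional k W] :
    X.dual.IsIndecomposable ↔ X.IsIndecomposable :=
  ⟨isIndecomposable_of_dual, fun hX =>
    isIndecomposable_of_dual (X.evalIso.isIndecomposable hX)⟩

end Dual

section Preinjective

variable {k V W : Type*} [Field k] [AddCommGroup V] [Module k V] [AddCommGroup W] [Module k W]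
  {r : ℕ}

@[simp]
theorem I_α₁_apply (x : Fin (r + 1) → k) (i : Fin r) : (I k r).α₁ x i = x i.castSucc := by
  simp [I, Matrix.mulVec, dotProduct]

@[simp]
theorem I_α₂_apply (x : Fin (r + 1) → k) (i : Fin r) : (I k r).α₂ x i = x i.succ := by
  simp [I, Matrix.mulVec, dotProduct]

theorem I_α₁_surjective : Function.Surjective (I k r).α₁ := fun y =>
  ⟨Fin.snoc y 0, by ext i; simp⟩

theorem eq_ite_of_toeplitz {M : Fin (r + 1) → Fin (r + 1) → k}
    (hM : ∀ i j : Fin r, M i.succ j.succ = M i.castSucc j.castSucc)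
    (hfirst : ∀ i : Fin r, M i.succ 0 = 0) (hlast : ∀ i : Fin r, M i.castSucc (Fin.last r) = 0)
    (i j : Fin (r + 1)) : M i j = if i = j then M 0 0 else 0 := by
  have hdiag (i : Fin (r + 1)) : M i i = M 0 0 := by
    induction i using Fin.induction with
    | zero => rfl
    | succ i ih => rw [hM, ih]
  have hbelow (j : Fin (r + 1)) : ∀ i, j < i → M i j = 0 := by
    induction j using Fin.induction with
    | zero => exact fun i hi => by simpa using hfirst (i.pred hi.ne')
    | succ j ih =>
      intro i hi
      obtain ⟨i, rfl⟩ := Fin.exists_succ_eq.2 (Fin.ne_zero_of_lt hi)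
      rw [hM, ih _ (Fin.castSucc_lt_castSucc_iff.2 (Fin.succ_lt_succ_iff.1 hi))]
  have habove (j : Fin (r + 1)) : ∀ i, i < j → M i j = 0 := by
    induction j using Fin.reverseInduction with
    | last => exact fun i hi => by simpa using hlast (i.castPred hi.ne)
    | cast j ih =>
      intro i hi
      obtain ⟨i, rfl⟩ := Fin.exists_castSucc_eq.2 (Fin.ne_last_of_lt hi)
      rw [← hM, ih _ (Fin.succ_lt_succ_iff.2 (Fin.castSucc_lt_castSucc_iff.1 hi))]
  rcases lt_trichotomy i j with h | rfl | h
  · rw [if_neg h.ne, habove j i h]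
  · rw [if_pos rfl, hdiag]
  · rw [if_neg h.ne', hbelow j i h]

@[simp]
theorem I_α₁_single_castSucc (i : Fin r) (c : k) :
    (I k r).α₁ (Pi.single i.castSucc c) = Pi.single i c := by
  ext j; simp [Pi.single_apply]

@[simp]
theorem I_α₁_single_last (c : k) : (I k r).α₁ (Pi.single (Fin.last r) c) = 0 := by
  ext j; simp [Fin.castSucc_ne_last]

@[simp]
theorem I_α₂_single_succ (i : Fin r) (c : k) :
    (I k r).α₂ (Pi.single i.succ c) = Pi.single i c := by
  ext j; simp [Pi.single_apply]

@[simp]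
theorem I_α₂_single_zero (c : k) : (I k r).α₂ (Pi.single 0 c) = 0 := by
  ext j; simp

theorem Hom.apply_eq_smul (f : (I k r).Hom (I k r)) :
    (∀ x, f.fst x = f.fst (Pi.single 0 1) 0 • x) ∧ ∀ y, f.snd y = f.fst (Pi.single 0 1) 0 • y := by
  have hfst (x) : f.fst x = f.fst (Pi.single 0 1) 0 • x := by
    have h₁ (j) (i : Fin r) : f.snd ((I k r).α₁ (Pi.single j 1)) i =
        f.fst (Pi.single j 1) i.castSucc := by rw [f.snd_α₁, I_α₁_apply]
    have h₂ (j) (i : Fin r) : f.snd ((I k r).α₂ (Pi.single j 1)) i =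
        f.fst (Pi.single j 1) i.succ := by rw [f.snd_α₂, I_α₂_apply]
    have hM := eq_ite_of_toeplitz (M := fun i j => f.fst (Pi.single j 1) i)
      (fun i j => by simp [← h₁, ← h₂]) (fun i => by simp [← h₂]) (fun i => by simp [← h₁])
    revert x
    refine LinearMap.ext_iff.1 (?_ : _ = f.fst (Pi.single 0 1) 0 • LinearMap.id)
    ext j i
    simpa [Pi.single_apply] using hM i j
  refine ⟨hfst, I_α₁_surjective.forall.2 fun x => ?_⟩
  rw [f.snd_α₁, hfst, map_smul]

theorem isIndecomposable_I : (I k r).IsIndecomposable := by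
  refine ⟨inferInstance, fun f hf => ?_⟩
  obtain ⟨h₁, h₂⟩ := f.apply_eq_smul
  set c := f.fst (Pi.single 0 1) 0
  have hc : c * c = c := by
    have := congr(($hf).fst (Pi.single 0 1) 0)
    simpa [h₁] using this
  refine (IsIdempotentElem.iff_eq_zero_or_one.1 hc).imp (fun h0 => ?_) fun h1 => ?_
  · exact Hom.ext (LinearMap.ext fun x => by simp [h₁, h0])
      (LinearMap.ext fun y => by simp [h₂, h0])
  · exact Hom.ext (LinearMap.ext fun x => by simp [h₁, h1])
      (LinearMap.ext fun y => by simp [h₂, h1])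

/-- A chain of length `n`: the coefficients of a polynomial `∑ vᵢ tⁱ` of degree less than `n`, with
non-zero constant term, that is killed by `α₂ - t α₁`. -/
structure IsChain (X : KroneckerRep k V W) (v : ℕ → V) (n : ℕ) : Prop where
  zero_ne_zero : v 0 ≠ 0
  α₂_zero : X.α₂ (v 0) = 0
  α₂_succ : ∀ i, X.α₂ (v (i + 1)) = X.α₁ (v i)
  eq_zero_of_le : ∀ i, n ≤ i → v i = 0

variable {X : KroneckerRep k V W} {v : ℕ → V}

/-- The morphism out of `I_r` that sends the basis vector `e_i` to the member `v i` of a chain. -/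
noncomputable def IsChain.hom (hv : X.IsChain v (r + 1)) : (I k r).Hom X where
  fst := Fintype.linearCombination k fun i : Fin (r + 1) => v i
  snd := Fintype.linearCombination k fun i : Fin r => X.α₁ (v i)
  snd_α₁ x := by
    have hlast : X.α₁ (v r) = 0 := by rw [← hv.α₂_succ, hv.eq_zero_of_le _ le_rfl, map_zero]
    simp [Fintype.linearCombination_apply, Fin.sum_univ_castSucc, hlast]
  snd_α₂ x := by simp [Fintype.linearCombination_apply, Fin.sum_univ_succ, hv.α₂_zero, hv.α₂_succ]

theorem IsChain.hom_fst_single_zero (hv : X.IsChain v (r + 1)) :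
    hv.hom.fst (Pi.single 0 1) = v 0 := by
  simp [hom]

variable (X r) in
/-- The inhomogeneous terms `(a, b)` for which the recursion
`z₀ = a₀`, `α₂ zᵢ₊₁ = α₁ zᵢ + α₂ aᵢ₊₁ + bᵢ` has a solution `z` that vanishes from `r` on. A chain of
length `r` that starts in `a₀` is a solution for `aᵢ₊₁ = bᵢ = 0`. -/
def solvableSubmodule : Submodule k ((ℕ → V) × (ℕ → W)) where
  carrier := {p | ∃ z : ℕ → V, z 0 = p.1 0 ∧ (∀ i, r ≤ i → z i = 0) ∧
    ∀ i < r, X.α₂ (z (i + 1)) = X.α₁ (z i) + X.α₂ (p.1 (i + 1)) + p.2 i}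
  zero_mem' := ⟨0, by simp⟩
  add_mem' := by
    rintro p p' ⟨z, h₁, h₂, h₃⟩ ⟨z', h₁', h₂', h₃'⟩
    refine ⟨z + z', by simp [h₁, h₁'], fun i hi => by simp [h₂ i hi, h₂' i hi], fun i hi => ?_⟩
    simp only [Pi.add_apply, Prod.fst_add, Prod.snd_add, map_add, h₃ i hi, h₃' i hi]
    abel
  smul_mem' := by
    rintro c p ⟨z, h₁, h₂, h₃⟩
    exact ⟨c • z, by simp [h₁], fun i hi => by simp [h₂ i hi], fun i hi => by simp [h₃ i hi]⟩

theorem single_zero_notMem_solvableSubmodule (hv : v 0 ≠ 0) (hα₂ : X.α₂ (v 0) = 0)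
    (hr : ∀ w, ¬ X.IsChain w r) : (Pi.single 0 (v 0), 0) ∉ X.solvableSubmodule r := by
  rintro ⟨z, h₁, h₂, h₃⟩
  simp only [Pi.single_eq_same] at h₁
  refine hr z ⟨h₁ ▸ hv, h₁ ▸ hα₂, fun i => ?_, h₂⟩
  rcases lt_or_ge i r with hi | hi
  · simpa using h₃ i hi
  · rw [h₂ i hi, h₂ (i + 1) (by omega), map_zero, map_zero]

theorem single_α₁_mem_solvableSubmodule {i : ℕ} (hi : i < r) (x : V) :
    (Pi.single i x, -Pi.single i (X.α₁ x)) ∈ X.solvableSubmodule r :=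
  ⟨Pi.single i x, rfl, fun j hj => Pi.single_eq_of_ne (by omega) _, fun j _ => by
    simp only [Pi.neg_apply, Pi.single_apply, apply_ite X.α₁, map_zero]
    abel⟩

theorem single_α₂_mem_solvableSubmodule (i : ℕ) (x : V) :
    (Pi.single (i + 1) x, -Pi.single i (X.α₂ x)) ∈ X.solvableSubmodule r :=
  ⟨0, by simp, fun j _ => rfl, fun j _ => by simp [Pi.single_apply, apply_ite X.α₂]⟩

theorem exists_hom_I_of_forall_not_isChain (hv : v 0 ≠ 0) (hα₂ : X.α₂ (v 0) = 0)
    (hr : ∀ w, ¬ X.IsChain w r) : ∃ f : X.Hom (I k r), f.fst (v 0) 0 = 1 := by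
  obtain ⟨G, hG, hGS⟩ :=
    Submodule.exists_le_ker_of_notMem (single_zero_notMem_solvableSubmodule hv hα₂ hr)
  let f (i : ℕ) : Module.Dual k V := G ∘ₗ .inl k _ _ ∘ₗ .single k (fun _ => V) i
  let g (i : ℕ) : Module.Dual k W := G ∘ₗ .inr k _ _ ∘ₗ .single k (fun _ => W) i
  have eq_of_mem {i j : ℕ} {x : V} {y : W}
      (h : (Pi.single j x, -Pi.single i y) ∈ X.solvableSubmodule r) : g i y = f j x := by
    have h0 : G ((Pi.single j x, 0) - (0, Pi.single i y)) = 0 := by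
      rw [Prod.mk_sub_mk, sub_zero, zero_sub]
      exact hGS h
    exact (sub_eq_zero.1 (by rwa [map_sub] at h0)).symm
  have hg₁ (i : Fin r) (x : V) : g i (X.α₁ x) = f i x :=
    eq_of_mem (single_α₁_mem_solvableSubmodule i.2 x)
  have hg₂ (i : Fin r) (x : V) : g i (X.α₂ x) = f (i + 1) x :=
    eq_of_mem (single_α₂_mem_solvableSubmodule i x)
  refine ⟨⟨(f 0 (v 0))⁻¹ • LinearMap.pi fun i : Fin (r + 1) => f i,
    (f 0 (v 0))⁻¹ • LinearMap.pi fun i : Fin r => g i, fun x => ?_, fun x => ?_⟩, ?_⟩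
  · ext i; simp [hg₁]
  · ext i; simp [hg₂]
  · simpa using inv_mul_cancel₀ (show f 0 (v 0) ≠ 0 from hG)

theorem IsIndecomposable.exists_iso_I_of_isChain (hX : X.IsIndecomposable) {n : ℕ}
    (hv : X.IsChain v n) : ∃ r, Nonempty (X.Iso (I k r)) := by
  classical
  have hn : ∃ n v, X.IsChain v n := ⟨n, v, hv⟩
  obtain ⟨v, hv⟩ := Nat.find_spec hn
  have hmin (w) (m) (hm : m < Nat.find hn) : ¬ X.IsChain w m := fun hw => Nat.find_min hn hm ⟨w, hw⟩
  obtain ⟨r, hr⟩ : ∃ r, Nat.find hn = r + 1 := Nat.exists_eq_succ_of_ne_zero fun h0 =>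
    hv.zero_ne_zero (hv.eq_zero_of_le 0 h0.le)
  rw [hr] at hv hmin
  obtain ⟨f, hf⟩ := exists_hom_I_of_forall_not_isChain hv.zero_ne_zero hv.α₂_zero
    (hmin · r r.lt_succ_self)
  obtain ⟨h₁, h₂⟩ := (f.comp hv.hom).apply_eq_smul
  have hone : (f.comp hv.hom).fst (Pi.single 0 1) 0 = 1 := by
    simp [hv.hom_fst_single_zero, hf]
  simp only [hone, one_smul] at h₁ h₂
  exact ⟨r, nonempty_iso_of_bijective_comp hX hv.hom f
    (by rw [LinearMap.ext (g := .id) h₁]; exact Function.bijective_id)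
    (by rw [LinearMap.ext (g := .id) h₂]; exact Function.bijective_id)⟩

end Preinjective

section Preprojective

variable {k V W : Type*} [Field k] [AddCommGroup V] [Module k V] [AddCommGroup W] [Module k W]

variable (k) in
/-- The isomorphism of `P_r` with the dual of `I_r` given by the standard bases. -/
noncomputable def isoDualI (r : ℕ) : (P k r).Iso (I k r).dual where
  fst := dotProductEquiv k (Fin r)
  snd := dotProductEquiv k (Fin (r + 1))
  snd_α₁ x := by
    ext j
    simpa [P, I, Matrix.mulVec, Matrix.col_apply'] using dotProduct_comm _ _
  snd_α₂ x := by
    ext j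
    simpa [P, I, Matrix.mulVec, Matrix.col_apply'] using dotProduct_comm _ _

theorem isIndecomposable_P (r : ℕ) : (P k r).IsIndecomposable :=
  (isoDualI k r).symm.isIndecomposable (isIndecomposable_dual_iff.2 isIndecomposable_I)

theorem IsIndecomposable.exists_iso_P_of_isChain_dual [FiniteDimensional k V]
    [FiniteDimensional k W] {X : KroneckerRep k V W} (hX : X.IsIndecomposable) {n : ℕ}
    {v : ℕ → Module.Dual k W} (hv : X.dual.IsChain v n) : ∃ r, Nonempty (X.Iso (P k r)) := by
  obtain ⟨r, ⟨e⟩⟩ := (isIndecomposable_dual_iff.2 hX).exists_iso_I_of_isChain hv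
  exact ⟨r, ⟨X.evalIso.trans (e.symm.dual.trans (isoDualI k r).symm)⟩⟩

end Preprojective

section Pencil

variable {k V W : Type*} [Field k] [AddCommGroup V] [Module k V] [AddCommGroup W] [Module k W]
  {X : KroneckerRep k V W}

theorem exists_isChain_of_recursion {c : ℕ → V} (h₀ : X.α₂ (c 0) = 0)
    (hsucc : ∀ i, X.α₂ (c (i + 1)) = X.α₁ (c i)) (hc : c ≠ 0) {n : ℕ} (hn : ∀ i, n ≤ i → c i = 0) :
    ∃ v, X.IsChain v n := by
  classical
  have hex : ∃ i, c i ≠ 0 := Function.ne_iff.1 hc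
  refine ⟨fun i => c (Nat.find hex + i), Nat.find_spec hex, ?_, fun i => hsucc _,
    fun i hi => hn _ (by omega)⟩
  rcases hd : Nat.find hex with _ | d
  · exact h₀
  · rw [add_zero, hsucc, not_not.1 (Nat.find_min hex (m := d) (by omega)), map_zero]

open Polynomial in
theorem exists_isChain_of_det_eq_zero [Infinite k] {ι : Type*} [Fintype ι] [DecidableEq ι]
    {A B : Matrix ι ι k} (h : ∀ t : k, (B - t • A).det = 0) :
    ∃ v n, IsChain ⟨A.toLin', B.toLin'⟩ v n := by
  let M : Matrix ι ι k[X] := B.map C - (X : k[X]) • A.map C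
  have hM : M.det = 0 := by
    refine Polynomial.funext fun t => ?_
    rw [eval_zero, ← h t, ← coe_evalRingHom, RingHom.map_det]
    congr 1
    ext i j
    simpa [M] using mul_comm _ _
  obtain ⟨p, hp, hMp⟩ := Matrix.exists_mulVec_eq_zero_iff.2 hM
  have hcoeff (d : ℕ) (i : ι) : (M.mulVec p i).coeff d = 0 := by rw [hMp]; exact coeff_zero d
  obtain ⟨v, hv⟩ := exists_isChain_of_recursion (X := ⟨A.toLin', B.toLin'⟩)
    (c := fun i j => (p j).coeff i) (n := (Finset.univ.sup fun j => (p j).natDegree) + 1)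
    (by
      ext i
      simpa [M, Matrix.mulVec, dotProduct, sub_mul, finsetSum_coeff, mul_assoc] using hcoeff 0 i)
    (fun d => by
      ext i
      simpa [M, Matrix.mulVec, dotProduct, sub_mul, finsetSum_coeff, mul_assoc, sub_eq_zero]
        using hcoeff (d + 1) i)
    (fun hc => hp (funext fun j => Polynomial.ext fun i => congr($hc i j)))
    (fun i hi => funext fun j => coeff_eq_zero_of_natDegree_lt
      ((Finset.le_sup (f := fun j => (p j).natDegree) (Finset.mem_univ j)).trans_lt hi))
  exact ⟨v, _, hv⟩

theorem IsChain.of_hom {V' W' : Type*} [AddCommGroup V'] [Module k V'] [AddCommGroup W']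
    [Module k W'] {Y : KroneckerRep k V' W'} {f : X.Hom Y} (h₁ : Function.Injective f.fst)
    (h₂ : Function.Injective f.snd) {v : ℕ → V} {n : ℕ} (hv : Y.IsChain (fun i => f.fst (v i)) n) :
    X.IsChain v n where
  zero_ne_zero h := hv.zero_ne_zero (by rw [h, map_zero])
  α₂_zero := h₂ (by rw [f.snd_α₂, hv.α₂_zero, map_zero])
  α₂_succ i := h₂ (by rw [f.snd_α₂, hv.α₂_succ, f.snd_α₁])
  eq_zero_of_le i hi := h₁ (by rw [hv.eq_zero_of_le i hi, map_zero])

theorem exists_injective_of_forall_not_isChain [Infinite k] [FiniteDimensional k V]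
    [FiniteDimensional k W] (hle : Module.finrank k W ≤ Module.finrank k V)
    (h : ∀ v n, ¬ X.IsChain v n) : ∃ t : k, Function.Injective (X.α₂ - t • X.α₁) := by
  by_contra! ht
  let e : V ≃ₗ[k] (Fin (Module.finrank k V) → k) := (Module.finBasis k V).equivFun
  let j : W →ₗ[k] (Fin (Module.finrank k V) → k) :=
    Function.ExtendByZero.linearMap k (Fin.castLE hle) ∘ₗ (Module.finBasis k W).equivFun.toLinearMap
  have hj : Function.Injective j := (Function.extend_injective (Fin.castLE_injective hle) 0).comp
    (Module.finBasis k W).equivFun.injective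
  let A := LinearMap.toMatrix' (j ∘ₗ X.α₁ ∘ₗ e.symm.toLinearMap)
  let B := LinearMap.toMatrix' (j ∘ₗ X.α₂ ∘ₗ e.symm.toLinearMap)
  let f : X.Hom ⟨A.toLin', B.toLin'⟩ := ⟨e, j, fun v => by simp [A], fun v => by simp [B]⟩
  have hdet (t : k) : (B - t • A).det = 0 := by
    by_contra hdet
    have happly (x : V) : (B - t • A).mulVec (e x) = j ((X.α₂ - t • X.α₁) x) := by
      simp [Matrix.sub_mulVec, Matrix.smul_mulVec, A, B, LinearMap.toMatrix'_mulVec]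
    exact ht t fun x y hxy => e.injective (Matrix.mulVec_injective_of_det_ne_zero hdet
      ((happly x).trans (congr(j $hxy).trans (happly y).symm)))
  obtain ⟨v, n, hv⟩ := exists_isChain_of_det_eq_zero hdet
  exact h (fun i => e.symm (v i)) n (.of_hom (f := f) e.injective hj (by simpa [f] using hv))

end Pencil

end KroneckerRep

section Nilpotent

variable {k V : Type*} [Field k] [AddCommGroup V] [Module k V]

theorem exists_mem_ker_of_isNilpotent {N : Module.End k V} (hN : IsNilpotent N) {U : Submodule k V}
    (hU : ∀ x ∈ U, N x ∈ U) (hne : U ≠ ⊥) : ∃ x ∈ U, x ≠ 0 ∧ N x = 0 := by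
  classical
  obtain ⟨x, hx, hx0⟩ := U.exists_mem_ne_zero_of_ne_bot hne
  have hpow : ∃ m, (N ^ m) x = 0 := hN.imp fun m hm => by rw [hm, LinearMap.zero_apply]
  obtain ⟨m, hm⟩ : ∃ m, Nat.find hpow = m + 1 :=
    Nat.exists_eq_succ_of_ne_zero fun h0 => hx0 (by simpa [h0] using Nat.find_spec hpow)
  have hmem (i : ℕ) : (N ^ i) x ∈ U := by
    induction i with
    | zero => exact hx
    | succ i ih => rw [pow_succ']; exact hU _ ih
  refine ⟨(N ^ m) x, hmem m, Nat.find_min hpow (by omega), ?_⟩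
  have := Nat.find_spec hpow
  rwa [hm, pow_succ'] at this

theorem injective_of_commute_of_ker_le_span {N : Module.End k V} (hN : IsNilpotent N) {v : V}
    (hker : LinearMap.ker N ≤ k ∙ v) {f : Module.End k V} (hf : Commute f N) (hv : f v ≠ 0) :
    Function.Injective f := by
  rw [← LinearMap.ker_eq_bot]
  by_contra hne
  obtain ⟨x, hx, hx0, hNx⟩ := exists_mem_ker_of_isNilpotent hN (U := LinearMap.ker f)
    (fun x hx => (congr($hf.eq x)).trans (by simp [LinearMap.mem_ker.1 hx])) hne
  obtain ⟨c, rfl⟩ := Submodule.mem_span_singleton.1 (hker hNx)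
  rw [LinearMap.mem_ker, map_smul] at hx
  exact (smul_eq_zero.1 hx).elim (fun hc => hx0 (by rw [hc, zero_smul])) hv

theorem eq_zero_or_eq_one_of_isIdempotentElem {p : Module.End k V} (hp : IsIdempotentElem p)
    {v : V} (hv : v ≠ 0) (h₀ : p v ≠ 0 → Function.Injective p)
    (h₁ : (1 - p : Module.End k V) v ≠ 0 → Function.Injective (1 - p : Module.End k V)) :
    p = 0 ∨ p = 1 := by
  by_cases hpv : p v = 0
  · refine .inl (LinearMap.ext fun x => h₁ (by simpa [hpv]) ?_)
    simpa using congr($hp.one_sub_mul_self x)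
  · refine .inr (LinearMap.ext fun x => h₀ hpv ?_)
    exact congr($hp.eq x)

end Nilpotent

section JordanBlock

variable {k : Type*} [Field k] {p q : ℕ}

theorem toLin'_jordanBlock (μ : k) :
    (jordanBlock p μ).toLin' = (jordanBlock p 0).toLin' + algebraMap k (Module.End k _) μ := by
  ext i j
  by_cases h : j = i <;> simp [jordanBlock, h]

theorem toLin'_jordanBlock_zero_apply (x : Fin p → k) (i : Fin p) :
    (jordanBlock p 0).toLin' x i = if h : i + 1 < p then x ⟨i + 1, h⟩ else 0 := by
  split_ifs with h
  · rw [Matrix.toLin'_apply, Matrix.mulVec, dotProduct, Finset.sum_eq_single ⟨i + 1, h⟩]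
    · simp [jordanBlock, Fin.ext_iff]
    · simp +contextual [jordanBlock, Fin.ext_iff]
    · simp
  · have (j : Fin p) : (j : ℕ) ≠ i + 1 := by omega
    simp [jordanBlock, Matrix.mulVec, dotProduct, this]

theorem toLin'_jordanBlock_zero_pow_apply (m : ℕ) (x : Fin p → k) (i : Fin p) :
    ((jordanBlock p 0).toLin' ^ m) x i = if h : i + m < p then x ⟨i + m, h⟩ else 0 := by
  induction m generalizing i with
  | zero => simp
  | succ m ih =>
    rw [pow_succ', Module.End.mul_apply, toLin'_jordanBlock_zero_apply]
    simp only [ih]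
    split_ifs <;> first | omega | rfl | congr 2; omega

theorem isNilpotent_toLin'_jordanBlock_zero :
    IsNilpotent (jordanBlock p (0 : k)).toLin' :=
  ⟨p, by ext; simp [toLin'_jordanBlock_zero_pow_apply]⟩

theorem ker_toLin'_jordanBlock_zero_le :
    LinearMap.ker (jordanBlock (q + 1) (0 : k)).toLin' ≤ k ∙ Pi.single 0 1 := by
  intro x hx
  refine Submodule.mem_span_singleton.2 ⟨x 0, ?_⟩
  ext i
  cases i using Fin.cases with
  | zero => simp
  | succ i =>
    have hi : x i.succ = 0 :=
      (dif_pos (by simp)).symm.trans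
        ((toLin'_jordanBlock_zero_apply x i.castSucc).symm.trans congr($hx i.castSucc))
    simp [hi]

end JordanBlock

namespace KroneckerRep

section Regular

variable {k V W V' W' : Type*} [Field k] [AddCommGroup V] [Module k V] [AddCommGroup W]
  [Module k W] [AddCommGroup V'] [Module k V'] [AddCommGroup W'] [Module k W']
  {X : KroneckerRep k V W} {Y : KroneckerRep k V' W'} {φ : Module.End k V} {q : ℕ}

theorem IsIndecomposable.of_forall_hom (hX : X.IsIndecomposable) {Y : KroneckerRep k V W}
    (h : ∀ f : Y.Hom Y, (∀ v, f.snd (X.α₁ v) = X.α₁ (f.fst v)) ∧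
      ∀ v, f.snd (X.α₂ v) = X.α₂ (f.fst v)) : Y.IsIndecomposable := by
  refine ⟨hX.1, fun f hf => ?_⟩
  let f' : X.Hom X := ⟨f.fst, f.snd, (h f).1, (h f).2⟩
  have hf' : f'.comp f' = f' := Hom.ext congr(($hf).fst) congr(($hf).snd)
  refine (hX.2 f' hf').imp (fun h0 => ?_) fun h1 => ?_
  · exact Hom.ext (congrArg Hom.fst h0 :) (congrArg Hom.snd h0 :)
  · exact Hom.ext (congrArg Hom.fst h1 :) (congrArg Hom.snd h1 :)

/-- The representation with the two arrows interchanged. -/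
def swap (X : KroneckerRep k V W) : KroneckerRep k V W := ⟨X.α₂, X.α₁⟩

/-- The change of coordinates `α₂ ↦ α₂ - t α₁` on the pencil spanned by `α₁` and `α₂`. -/
@[simps]
def shear (t : k) (X : KroneckerRep k V W) : KroneckerRep k V W := ⟨X.α₁, X.α₂ - t • X.α₁⟩

theorem IsIndecomposable.swap (hX : X.IsIndecomposable) : X.swap.IsIndecomposable :=
  hX.of_forall_hom fun f => ⟨f.snd_α₂, f.snd_α₁⟩

theorem IsIndecomposable.shear (hX : X.IsIndecomposable) (t : k) :
    (X.shear t).IsIndecomposable :=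
  hX.of_forall_hom fun f => ⟨f.snd_α₁, fun v => by
    have h₁ : f.snd (X.α₁ v) = X.α₁ (f.fst v) := f.snd_α₁ v
    simpa [h₁] using f.snd_α₂ v⟩

/-- An isomorphism, as an isomorphism of the representations with interchanged arrows. -/
def Iso.swap (e : X.Iso Y) : X.swap.Iso Y.swap := ⟨e.fst, e.snd, e.snd_α₂, e.snd_α₁⟩

/-- The representation `(φ, id)` given by an endomorphism `φ`. -/
@[simps]
def ofEnd (φ : Module.End k V) : KroneckerRep k V V := ⟨φ, .id⟩

/-- A representation with bijective `α₂` is given by the endomorphism `α₂⁻¹ α₁`. -/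
noncomputable def isoOfEnd (X : KroneckerRep k V W) (h : Function.Bijective X.α₂) :
    X.Iso (ofEnd ((LinearEquiv.ofBijective X.α₂ h).symm.toLinearMap ∘ₗ X.α₁)) where
  fst := .refl k V
  snd := (LinearEquiv.ofBijective X.α₂ h).symm
  snd_α₁ _ := rfl
  snd_α₂ v := (LinearEquiv.ofBijective X.α₂ h).symm_apply_apply v

theorem isIndecomposable_ofEnd_iff : (ofEnd φ).IsIndecomposable ↔
    Nontrivial V ∧ ∀ p : Module.End k V, Commute p φ → IsIdempotentElem p → p = 0 ∨ p = 1 := by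
  refine ⟨fun h => ⟨?_, fun p hc hp => ?_⟩, fun h => ⟨have := h.1; inferInstance, fun f hf => ?_⟩⟩
  · by_contra hV
    have := not_nontrivial_iff_subsingleton.1 hV
    exact not_subsingleton_iff_nontrivial.2 h.1 inferInstance
  · exact (h.2 ⟨p, p, fun v => congr($hc v), fun _ => rfl⟩ (Hom.ext hp hp)).imp
      (congrArg Hom.fst) (congrArg Hom.fst)
  · have hs : f.snd = f.fst := LinearMap.ext f.snd_α₂
    have hc : Commute f.fst φ := LinearMap.ext fun v => (congr($hs (φ v))).symm.trans (f.snd_α₁ v)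
    exact (h.2 f.fst hc congr(($hf).fst)).imp (fun h0 => Hom.ext h0 (hs.trans h0))
      fun h1 => Hom.ext h1 (hs.trans h1)

theorem isIndecomposable_ofEnd_add_algebraMap_iff (μ : k) :
    (ofEnd (φ + algebraMap k _ μ)).IsIndecomposable ↔ (ofEnd φ).IsIndecomposable := by
  have hcomm (p : Module.End k V) : Commute p (φ + algebraMap k _ μ) ↔ Commute p φ :=
    ⟨fun h => by simpa using h.sub_right (Algebra.commutes μ p).symm,
      fun h => h.add_right (Algebra.commutes μ p).symm⟩
  simp only [isIndecomposable_ofEnd_iff, hcomm]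

theorem isNilpotent_or_bijective_of_isIndecomposable_ofEnd [FiniteDimensional k V]
    (h : (ofEnd φ).IsIndecomposable) : IsNilpotent φ ∨ Function.Bijective φ := by
  obtain ⟨n, hn, hc⟩ :=
    ((Filter.eventually_ge_atTop 1).and φ.eventually_isCompl_ker_pow_range_pow).exists
  have hcomm : Commute ((LinearMap.ker (φ ^ n)).projection _ hc) φ := by
    rw [LinearMap.IsIdempotentElem.commute_iff (Submodule.isIdempotentElem_projection hc),
      Submodule.range_projection, Submodule.ker_projection]
    have hφ : Commute (φ ^ n) φ := (Commute.refl φ).pow_left n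
    refine ⟨fun v hv => ?_, ?_⟩
    · exact (congr($hφ v)).trans (by simp [LinearMap.mem_ker.1 hv])
    · rintro _ ⟨v, rfl⟩
      exact ⟨φ v, congr($hφ v)⟩
  refine ((isIndecomposable_ofEnd_iff.1 h).2 _ hcomm
    (Submodule.isIdempotentElem_projection hc)).symm.imp (fun h1 => ⟨n, ?_⟩) fun h0 => ?_
  · rw [← LinearMap.range_eq_bot, ← Submodule.ker_projection hc, h1]
    exact LinearMap.ker_id
  · have hker : LinearMap.ker (φ ^ n) = ⊥ := by
      rw [← Submodule.range_projection hc, h0]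
      exact LinearMap.range_zero
    have hinj : Function.Injective φ := by
      obtain ⟨m, rfl⟩ := Nat.exists_eq_add_of_le' hn
      refine .of_comp (f := (φ ^ m : Module.End k V)) ?_
      rw [← LinearMap.coe_comp, ← Module.End.mul_eq_comp, ← pow_succ]
      exact LinearMap.ker_eq_bot.1 hker
    exact ⟨hinj, LinearMap.injective_iff_surjective.1 hinj⟩

theorem isIndecomposable_ofEnd_jordanBlock (μ : k) :
    (ofEnd (jordanBlock (q + 1) μ).toLin').IsIndecomposable := by
  rw [toLin'_jordanBlock, isIndecomposable_ofEnd_add_algebraMap_iff, isIndecomposable_ofEnd_iff]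
  have hinj {f : Module.End k (Fin (q + 1) → k)} (hf : Commute f (jordanBlock (q + 1) 0).toLin') :
      f (Pi.single 0 1) ≠ 0 → Function.Injective f :=
    injective_of_commute_of_ker_le_span (V := Fin (q + 1) → k) isNilpotent_toLin'_jordanBlock_zero
      ker_toLin'_jordanBlock_zero_le hf
  exact ⟨inferInstance, fun p hc hp => eq_zero_or_eq_one_of_isIdempotentElem hp
    (Pi.single_ne_zero_iff.2 one_ne_zero) (hinj hc) (hinj ((Commute.one_left _).sub_left hc))⟩

end Regular

section Tube

variable {k V W V' : Type*} [Field k] [AddCommGroup V] [Module k V] [AddCommGroup W]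
  [Module k W] [AddCommGroup V'] [Module k V'] {X : KroneckerRep k V W} {N φ : Module.End k V}
  {ψ : Module.End k V'} {q : ℕ}

/-- The morphism from the nilpotent Jordan block to `N` that sends `e_i` to `N^(q-i) v`. -/
noncomputable def homOfJordanBlock (hN : N ^ (q + 1) = 0) (v : V) :
    (ofEnd (jordanBlock (q + 1) 0).toLin').Hom (ofEnd N) where
  fst := Fintype.linearCombination k fun i : Fin (q + 1) => (N ^ (q - i : ℕ)) v
  snd := Fintype.linearCombination k fun i : Fin (q + 1) => (N ^ (q - i : ℕ)) v
  snd_α₁ x := by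
    have hpow (m : ℕ) : N ((N ^ m) v) = (N ^ (m + 1)) v := by rw [pow_succ', Module.End.mul_apply]
    have hsucc (i : Fin q) : q - (i + 1 : ℕ) + 1 = q - i := by omega
    simp only [ofEnd_α₁, Fintype.linearCombination_apply, map_sum, map_smul, hpow]
    rw [Fin.sum_univ_castSucc, Fin.sum_univ_succ]
    simp [toLin'_jordanBlock_zero_apply, hN, hsucc, Fin.succ]
  snd_α₂ _ := rfl

/-- The morphism from `N` to the nilpotent Jordan block with the components `f ∘ N^i`. -/
noncomputable def homToJordanBlock (hN : N ^ (q + 1) = 0) (f : Module.Dual k V) :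
    (ofEnd N).Hom (ofEnd (jordanBlock (q + 1) 0).toLin') where
  fst := LinearMap.pi fun i => f ∘ₗ (N ^ (i : ℕ))
  snd := LinearMap.pi fun i => f ∘ₗ (N ^ (i : ℕ))
  snd_α₁ x := by
    ext i
    simp only [ofEnd_α₁, toLin'_jordanBlock_zero_apply, LinearMap.pi_apply, LinearMap.comp_apply,
      ← Module.End.mul_apply, ← pow_succ]
    split_ifs with h
    · rfl
    · rw [show (i : ℕ) = q by omega, hN, LinearMap.zero_apply, map_zero]
  snd_α₂ _ := rfl

theorem IsIndecomposable.exists_iso_jordanBlock_of_isNilpotent (h : (ofEnd N).IsIndecomposable)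
    (hN : IsNilpotent N) :
    ∃ q, Nonempty ((ofEnd N).Iso (ofEnd (jordanBlock (q + 1) 0).toLin')) := by
  have hV := (isIndecomposable_ofEnd_iff.1 h).1
  obtain ⟨q, hq⟩ : ∃ q, nilpotencyClass N = q + 1 :=
    Nat.exists_eq_succ_of_ne_zero (pos_nilpotencyClass_iff.2 hN).ne'
  have hq₁ : N ^ (q + 1) = 0 := hq ▸ pow_nilpotencyClass hN
  obtain ⟨v, hv⟩ : ∃ v, (N ^ q) v ≠ 0 := by
    have : N ^ q ≠ 0 := by simpa [hq] using pow_pred_nilpotencyClass hN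
    simpa [LinearMap.ext_iff] using this
  obtain ⟨f, hf⟩ := not_forall.1 ((Module.forall_dual_apply_eq_zero_iff k _).not.2 hv)
  let u := ((homToJordanBlock hq₁ f).comp (homOfJordanBlock hq₁ v)).fst
  have hu : Commute u (jordanBlock (q + 1) 0).toLin' := LinearMap.ext
    ((homToJordanBlock hq₁ f).comp (homOfJordanBlock hq₁ v)).snd_α₁
  have hu₀ : u (Pi.single 0 1) ≠ 0 := fun h0 => hf (by
    simpa [u, homToJordanBlock, homOfJordanBlock] using congr($h0 0))
  have hinj : Function.Injective u :=
    injective_of_commute_of_ker_le_span (V := Fin (q + 1) → k) isNilpotent_toLin'_jordanBlock_zero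
      ker_toLin'_jordanBlock_zero_le hu hu₀
  have hbij : Function.Bijective u := ⟨hinj, LinearMap.injective_iff_surjective.1 hinj⟩
  exact ⟨q, nonempty_iso_of_bijective_comp h _ _ hbij hbij⟩

/-- An isomorphism of endomorphisms, as an isomorphism of their translates by a scalar. -/
def Iso.addAlgebraMap (e : (ofEnd φ).Iso (ofEnd ψ)) (μ : k) :
    (ofEnd (φ + algebraMap k _ μ)).Iso (ofEnd (ψ + algebraMap k _ μ)) where
  fst := e.fst
  snd := e.snd
  snd_α₁ v := by
    have h₁ : e.snd (φ v) = ψ (e.fst v) := e.snd_α₁ v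
    have h₂ : e.snd v = e.fst v := e.snd_α₂ v
    simp [h₁, h₂]
  snd_α₂ := e.snd_α₂

theorem IsIndecomposable.exists_iso_jordanBlock [IsAlgClosed k] [FiniteDimensional k V]
    (h : (ofEnd φ).IsIndecomposable) :
    ∃ q μ, Nonempty ((ofEnd φ).Iso (ofEnd (jordanBlock (q + 1) μ).toLin')) := by
  have hV := (isIndecomposable_ofEnd_iff.1 h).1
  obtain ⟨μ, hμ⟩ := Module.End.exists_eigenvalue φ
  have hadd : φ - algebraMap k _ μ + algebraMap k _ μ = φ := sub_add_cancel _ _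
  have hsub : (ofEnd (φ - algebraMap k _ μ)).IsIndecomposable := by
    rwa [← isIndecomposable_ofEnd_add_algebraMap_iff μ, hadd]
  have hnil : IsNilpotent (φ - algebraMap k _ μ) :=
    (isNilpotent_or_bijective_of_isIndecomposable_ofEnd hsub).resolve_right fun hb => by
      obtain ⟨v, hv⟩ := hμ.exists_hasEigenvector
      exact hv.2 (hb.1 (by simp [hv.apply_eq_smul]))
  obtain ⟨q, ⟨e⟩⟩ := hsub.exists_iso_jordanBlock_of_isNilpotent hnil
  exact ⟨q, μ, ⟨by simpa only [hadd, ← toLin'_jordanBlock] using e.addAlgebraMap μ⟩⟩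

theorem IsIndecomposable.bijective_α₁_or_bijective_α₂ [FiniteDimensional k V]
    (hX : X.IsIndecomposable) {t : k} (ht : Function.Bijective (X.α₂ - t • X.α₁)) :
    Function.Bijective X.α₁ ∨ Function.Bijective X.α₂ := by
  let e := LinearEquiv.ofBijective _ ht
  have he : (e : V →ₗ[k] W) = X.α₂ - t • X.α₁ := rfl
  set ψ : Module.End k V := e.symm.toLinearMap ∘ₗ X.α₁
  have hα₁ : X.α₁ = e.toLinearMap ∘ₗ ψ := by ext v; simp [ψ]
  have hα₂ : X.α₂ = e.toLinearMap ∘ₗ (1 + t • ψ) := by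
    rw [Module.End.one_eq_id, LinearMap.comp_add, LinearMap.comp_id, LinearMap.comp_smul, ← hα₁, he,
      sub_add_cancel]
  rcases isNilpotent_or_bijective_of_isIndecomposable_ofEnd
    (((X.shear t).isoOfEnd ht).isIndecomposable (hX.shear t)) with hψ | hψ
  · right
    rw [hα₂]
    exact e.bijective.comp ((Module.End.isUnit_iff _).1 (hψ.smul t).isUnit_one_add)
  · left
    rw [hα₁]
    exact e.bijective.comp hψ

theorem IsIndecomposable.exists_iso_R [IsAlgClosed k] [FiniteDimensional k V]
    (hX : X.IsIndecomposable) {t : k} (ht : Function.Bijective (X.α₂ - t • X.α₁)) :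
    ∃ q l, Nonempty (X.Iso (R (q + 1) l)) := by
  by_cases h₂ : Function.Bijective X.α₂
  · obtain ⟨q, μ, ⟨e⟩⟩ := ((X.isoOfEnd h₂).isIndecomposable hX).exists_iso_jordanBlock
    refine ⟨q, .mk k ![μ, 1] (by simp), ?_⟩
    rw [R_affine]
    exact ⟨(X.isoOfEnd h₂).trans e⟩
  · have h₁ := (hX.bijective_α₁_or_bijective_α₂ ht).resolve_right h₂
    let e := X.swap.isoOfEnd h₁
    have hψ := e.isIndecomposable hX.swap
    have hnil := (isNilpotent_or_bijective_of_isIndecomposable_ofEnd hψ).resolve_right fun hb =>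
      h₂ (((LinearEquiv.ofBijective _ h₁).symm.comp_bijective _).1 hb)
    obtain ⟨q, ⟨e'⟩⟩ := hψ.exists_iso_jordanBlock_of_isNilpotent hnil
    refine ⟨q, .mk k ![1, 0] (by simp), ?_⟩
    rw [R_infinity]
    exact ⟨(e.trans e').swap⟩

end Tube

section Classification

variable {k V W : Type*} [Field k] [AddCommGroup V] [Module k V] [AddCommGroup W] [Module k W]

theorem isIndecomposable_R (q : ℕ) (l : Projectivization k (Fin 2 → k)) :
    (R (q + 1) l).IsIndecomposable := by
  rw [R]
  split_ifs
  · exact (isIndecomposable_ofEnd_jordanBlock 0).swap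
  · exact isIndecomposable_ofEnd_jordanBlock _

theorem IsIndecomposable.exists_iso_P_or_I_or_R [IsAlgClosed k] [FiniteDimensional k V]
    [FiniteDimensional k W] {X : KroneckerRep k V W} (hX : X.IsIndecomposable) :
    (∃ r, Nonempty (X.Iso (P k r))) ∨ (∃ r, Nonempty (X.Iso (I k r))) ∨
      ∃ q l, Nonempty (X.Iso (R (q + 1) l)) := by
  by_cases hI : ∃ v n, X.IsChain v n
  · obtain ⟨v, n, hv⟩ := hI
    exact .inr (.inl (hX.exists_iso_I_of_isChain hv))
  by_cases hP : ∃ v n, X.dual.IsChain v n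
  · obtain ⟨v, n, hv⟩ := hP
    exact .inl (hX.exists_iso_P_of_isChain_dual hv)
  push Not at hI hP
  rcases le_or_gt (Module.finrank k W) (Module.finrank k V) with hle | hlt
  · obtain ⟨t, ht⟩ := exists_injective_of_forall_not_isChain hle hI
    have hfin := le_antisymm (LinearMap.finrank_le_finrank_of_injective ht) hle
    exact .inr (.inr (hX.exists_iso_R
      ⟨ht, (LinearMap.injective_iff_surjective_of_finrank_eq_finrank hfin).1 ht⟩))
  · obtain ⟨t, ht⟩ := exists_injective_of_forall_not_isChain
      (by simpa only [Subspace.dual_finrank_eq] using hlt.le) hP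
    have hfin := LinearMap.finrank_le_finrank_of_injective ht
    rw [Subspace.dual_finrank_eq, Subspace.dual_finrank_eq] at hfin
    omega

end Classification

end KroneckerRep

section RegularRepresentation

open Representation

variable {k G V W : Type*} [Field k] [Group G] [AddCommGroup V] [Module k V] [AddCommGroup W]
  [Module k W] {ρ : Representation k G V} {σ : Representation k G W}

theorem exists_mem_invariants_of_isPGroup [Finite G] {p : ℕ} [Fact p.Prime] [CharP k p]
    (hG : IsPGroup p G) {U : Subrepresentation ρ} (hU : U ≠ ⊥) :
    ∃ x ∈ U.toSubmodule, x ≠ 0 ∧ x ∈ ρ.invariants := by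
  obtain ⟨x, hxU, hx0⟩ := U.toSubmodule.exists_mem_ne_zero_of_ne_bot
    fun h => hU (Subrepresentation.toSubmodule_injective h)
  have htorsion (v : V) : p • v = 0 := by
    rw [← Nat.cast_smul_eq_nsmul k, CharP.cast_eq_zero, zero_smul]
  let S := AddSubgroup.closure (Set.range fun g => ρ g x)
  have hSρ (g : G) : S ≤ S.comap (ρ g).toAddMonoidHom := by
    refine (AddSubgroup.closure_le _).2 ?_
    rintro _ ⟨h, rfl⟩
    exact AddSubgroup.subset_closure ⟨g * h, by simp⟩
  have hSU : S ≤ U.toSubmodule.toAddSubgroup := by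
    refine (AddSubgroup.closure_le _).2 ?_
    rintro _ ⟨g, rfl⟩
    exact U.apply_mem_toSubmodule g hxU
  have hxS : x ∈ S := AddSubgroup.subset_closure ⟨1, by simp⟩
  let : MulAction G S :=
    { smul g s := ⟨ρ g s, hSρ g s.2⟩
      one_smul s := Subtype.ext (by change ρ 1 s = s; simp)
      mul_smul g h s := Subtype.ext (by change ρ (g * h) s = ρ g (ρ h s); simp) }
  have : AddGroup.FG S := AddGroup.closure_finite_fg _
  have : Finite S := AddCommGroup.finite_of_fg_isAddTorsion S fun s =>
    isOfFinAddOrder_iff_nsmul_eq_zero.2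
      ⟨p, (Fact.out : p.Prime).pos, Subtype.ext (htorsion s)⟩
  have hdvd : p ∣ Nat.card S := by
    rw [← addOrderOf_eq_prime (x := (⟨x, hxS⟩ : S)) (Subtype.ext (htorsion x)) (by simpa)]
    exact addOrderOf_dvd_natCard _
  obtain ⟨y, hy, hy0⟩ := hG.exists_fixed_point_of_prime_dvd_card_of_fixed_point S hdvd (a := 0)
    fun g => Subtype.ext (map_zero (ρ g))
  exact ⟨y, hSU y.2, fun h => hy0 (Subtype.ext h.symm), fun g => congr(($(hy g) : S).1)⟩

theorem leftRegular_norm_single_ne_zero [Fintype G] :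
    (leftRegular k G).norm (.single 1 1) ≠ 0 := by
  rw [Ne, leftRegular_norm_eq_zero_iff]
  simp

theorem eq_smul_norm_of_mem_invariants [Fintype G] {x : MonoidAlgebra k G}
    (hx : x ∈ (leftRegular k G).invariants) :
    x = x.coeff 1 • (leftRegular k G).norm (.single 1 1) := by
  have hcoeff (g : G) : x.coeff g = x.coeff 1 := by
    have := congr(($(hx g)).coeff g)
    rw [coeff_ofMulAction] at this
    simpa using this.symm
  ext g
  simp [Representation.norm, hcoeff]

theorem map_norm [Fintype G] (f : σ.IntertwiningMap ρ) (v : W) : f (σ.norm v) = ρ.norm (f v) := by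
  simp only [Representation.norm, LinearMap.sum_apply, map_sum, IntertwiningMap.isIntertwining]

theorem injective_of_norm_ne_zero [Fintype G] {p : ℕ} [Fact p.Prime] [CharP k p] (hG : IsPGroup p G)
    (f : (leftRegular k G).IntertwiningMap ρ) (hf : ρ.norm (f (.single 1 1)) ≠ 0) :
    Function.Injective f := by
  have hbot : IntertwiningMap.ker _ _ f = ⊥ := by
    by_contra hne
    obtain ⟨x, hfx, hx0, hx⟩ := exists_mem_invariants_of_isPGroup hG hne
    have hfx : f x = 0 := hfx
    rw [eq_smul_norm_of_mem_invariants hx, map_smul, map_norm] at hfx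
    refine hx0 ?_
    rw [eq_smul_norm_of_mem_invariants hx, (smul_eq_zero.1 hfx).resolve_right hf, zero_smul]
  exact LinearMap.ker_eq_bot.1 congr(($hbot).toSubmodule)

/-- The map `v ↦ ∑ g, f (g⁻¹ v) g` to the regular representation that is induced by a linear
form `f`. -/
noncomputable def toLeftRegular [Finite G] (ρ : Representation k G V) (f : Module.Dual k V) :
    ρ.IntertwiningMap (leftRegular k G) :=
  LinearMap.intertwiningMap_of_isIntertwiningMap ρ _
    ((MonoidAlgebra.coeffLinearEquiv k).symm.toLinearMap ∘ₗ
      (Finsupp.linearEquivFunOnFinite k k G).symm.toLinearMap ∘ₗ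
      LinearMap.pi fun g => f ∘ₗ ρ g⁻¹) fun h x => by
    refine MonoidAlgebra.coeff_injective (Finsupp.ext fun g => ?_)
    rw [coeff_ofMulAction]
    simp

theorem coeff_toLeftRegular [Finite G] (f : Module.Dual k V) (v : V) (g : G) :
    (toLeftRegular ρ f v).coeff g = f (ρ g⁻¹ v) := rfl

theorem exists_comp_eq_id_of_injective [Finite G] {s : (leftRegular k G).IntertwiningMap ρ}
    (hs : Function.Injective s) :
    ∃ r : ρ.IntertwiningMap (leftRegular k G), r.comp s = .id _ := by
  obtain ⟨l, hl⟩ := s.toLinearMap.exists_leftInverse_of_injective (LinearMap.ker_eq_bot.2 hs)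
  have hl (x : MonoidAlgebra k G) : l (s x) = x := congr($hl x)
  refine ⟨toLeftRegular ρ (Finsupp.lapply 1 ∘ₗ
    (MonoidAlgebra.coeffLinearEquiv k).toLinearMap ∘ₗ l), ?_⟩
  refine IntertwiningMap.ext (LinearMap.ext fun x => ?_)
  ext g
  change (toLeftRegular ρ _ (s x)).coeff g = x.coeff g
  rw [coeff_toLeftRegular, ← IntertwiningMap.isIntertwining]
  simp [hl]

theorem nonempty_equiv_leftRegular [Fintype G] {p : ℕ} [Fact p.Prime] [CharP k p]
    (hG : IsPGroup p G) (hρ : ρ.IsIndecomposable) (hnorm : ρ.norm ≠ 0) :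
    Nonempty (ρ.Equiv (leftRegular k G)) := by
  obtain ⟨v, hv⟩ := DFunLike.ne_iff.1 hnorm
  have hs := injective_of_norm_ne_zero hG ((leftRegularMapEquiv ρ).symm v)
    (by simpa [leftRegularMapEquiv_symm_single] using hv)
  obtain ⟨r, hr⟩ := exists_comp_eq_id_of_injective hs
  exact nonempty_equiv_of_bijective_comp hρ _ r (by rw [hr]; exact Function.bijective_id)

theorem isIndecomposable_leftRegular [Finite G] {p : ℕ} [Fact p.Prime] [CharP k p]
    (hG : IsPGroup p G) : (leftRegular k G).IsIndecomposable := by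
  have := Fintype.ofFinite G
  refine isIndecomposable_iff_forall_idempotent.2 ⟨inferInstance, fun e he => ?_⟩
  have hinj (f : Module.End k (MonoidAlgebra k G)) (hf : ∀ g, Commute f (leftRegular k G g))
      (hne : f ((leftRegular k G).norm (.single 1 1)) ≠ 0) : Function.Injective f := by
    let F : (leftRegular k G).IntertwiningMap (leftRegular k G) := ⟨f, hf⟩
    exact injective_of_norm_ne_zero hG F (map_norm F _ ▸ hne)
  have he' (g : G) : Commute e.toLinearMap (leftRegular k G g) := e.isIntertwining' g
  have hidem : IsIdempotentElem e.toLinearMap := congr(($he).toLinearMap)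
  exact (eq_zero_or_eq_one_of_isIdempotentElem hidem leftRegular_norm_single_ne_zero (hinj _ he')
    (hinj _ fun g => (Commute.one_left _).sub_left (he' g))).imp
    (fun h => IntertwiningMap.ext h) fun h => IntertwiningMap.ext h

end RegularRepresentation

namespace KleinFour

open Representation

theorem cases_generators (g : KleinFour) : g = 1 ∨ g = g₁ ∨ g = g₂ ∨ g = g₁ * g₂ := by
  revert g
  decide

theorem isPGroup_two : IsPGroup 2 KleinFour := .of_card (n := 2) (by simp)

section Ring

variable {k V V' : Type*} [Field k] [AddCommGroup V] [Module k V] [AddCommGroup V'] [Module k V']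
  {ρ : Representation k KleinFour V} {σ : Representation k KleinFour V'}

/-- The intertwining map given by a linear map that commutes with the two generators. -/
def intertwiningMap (f : V →ₗ[k] V') (h₁ : ∀ v, f (ρ g₁ v) = σ g₁ (f v))
    (h₂ : ∀ v, f (ρ g₂ v) = σ g₂ (f v)) : ρ.IntertwiningMap σ :=
  f.intertwiningMap_of_isIntertwiningMap ρ σ fun g v => by
    rcases cases_generators g with rfl | rfl | rfl | rfl <;> simp [h₁, h₂]

theorem commute_sub_one : Commute (ρ g₁ - 1) (ρ g₂ - 1) :=
  ((((Commute.all g₁ g₂).map ρ).sub_left (.one_left _)).sub_right (.one_right _))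

theorem two_eq_zero_end [CharP k 2] : (2 : Module.End k V) = 0 := by
  rw [← map_ofNat (algebraMap k (Module.End k V)) 2, CharTwo.two_eq_zero, map_zero]

theorem sub_one_mul_self [CharP k 2] {g : KleinFour} (hg : g * g = 1) :
    (ρ g - 1) * (ρ g - 1) = 0 := by
  calc (ρ g - 1) * (ρ g - 1) = ρ (g * g) + 1 - 2 * ρ g := by rw [map_mul]; noncomm_ring
    _ = 0 := by rw [hg, map_one, one_add_one_eq_two, two_eq_zero_end, zero_mul, sub_zero]

theorem norm_eq [CharP k 2] : ρ.norm = (ρ g₁ - 1) * (ρ g₂ - 1) := by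
  have huniv : (Finset.univ : Finset KleinFour) = {1, g₁, g₂, g₁ * g₂} := by decide
  calc ρ.norm = 1 + (ρ g₁ + (ρ g₂ + ρ g₁ * ρ g₂)) := by
        rw [Representation.norm, huniv, Finset.sum_insert (by decide),
          Finset.sum_insert (by decide), Finset.sum_insert (by decide), Finset.sum_singleton,
          map_one, map_mul]
    _ = (ρ g₁ - 1) * (ρ g₂ - 1) + 2 * (ρ g₁ + ρ g₂) := by noncomm_ring
    _ = (ρ g₁ - 1) * (ρ g₂ - 1) := by rw [two_eq_zero_end, zero_mul, add_zero]

end Ring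

end KleinFour

namespace KroneckerRep

open KleinFour Representation

section JointlySurjective

variable {k V W : Type*} [Field k] [AddCommGroup V] [Module k V] [AddCommGroup W] [Module k W]

/-- The images of the two maps of `X` span its second space; equivalently, `X` has no direct
summand `P_0`. -/
def IsJointlySurjective (X : KroneckerRep k V W) : Prop := X.α₁.range ⊔ X.α₂.range = ⊤

theorem IsIndecomposable.isJointlySurjective [Nontrivial V] {X : KroneckerRep k V W}
    (hX : X.IsIndecomposable) :
    X.IsJointlySurjective := by
  obtain ⟨N, hN⟩ := Submodule.exists_isCompl (X.α₁.range ⊔ X.α₂.range)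
  have hα₁ (v : V) : X.α₁ v ∈ X.α₁.range ⊔ X.α₂.range := Submodule.mem_sup_left ⟨v, rfl⟩
  have hα₂ (v : V) : X.α₂ v ∈ X.α₁.range ⊔ X.α₂.range := Submodule.mem_sup_right ⟨v, rfl⟩
  let π : X.Hom X := ⟨.id, Submodule.projection _ N hN,
    fun v => Submodule.projection_apply_of_mem_left hN (hα₁ v),
    fun v => Submodule.projection_apply_of_mem_left hN (hα₂ v)⟩
  have hπ : π.comp π = π :=
    Hom.ext rfl (Submodule.isIdempotentElem_projection hN)
  rcases hX.2 π hπ with h | h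
  · obtain ⟨v, hv⟩ := exists_ne (0 : V)
    exact absurd congr(($h).fst v) hv
  · have hsnd : Submodule.projection _ N hN = .id := congr(($h).snd)
    rw [IsJointlySurjective, ← Submodule.range_projection hN, hsnd, LinearMap.range_id]

end JointlySurjective

section Functor

variable {k V W V' W' V'' W'' : Type*} [Field k] [CharP k 2] [AddCommGroup V] [Module k V]
  [AddCommGroup W] [Module k W] [AddCommGroup V'] [Module k V'] [AddCommGroup W'] [Module k W']
  [AddCommGroup V''] [Module k V''] [AddCommGroup W''] [Module k W'']
  {X : KroneckerRep k V W} {Y : KroneckerRep k V' W'} {Z : KroneckerRep k V'' W''}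

@[simp]
theorem T_g₁_apply (z : V × W) : X.T g₁ z = (z.1, z.2 + X.α₁ z.1) := by
  rw [T, loopRepresentation_g₁]
  ext <;> simp [lowerBlock]

@[simp]
theorem T_g₂_apply (z : V × W) : X.T g₂ z = (z.1, z.2 + X.α₂ z.1) := by
  rw [T, loopRepresentation_g₂]
  ext <;> simp [lowerBlock]

theorem norm_T : X.T.norm = 0 := by
  rw [norm_eq, T, loopRepresentation_g₁, loopRepresentation_g₂, add_sub_cancel_left,
    add_sub_cancel_left, lowerBlock_mul]

/-- The action of the functor `T` on morphisms. -/
def Hom.T (f : X.Hom Y) : X.T.IntertwiningMap Y.T :=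
  intertwiningMap (f.fst.prodMap f.snd) (by simp [f.snd_α₁]) (by simp [f.snd_α₂])

theorem Hom.T_apply (f : X.Hom Y) (z : V × W) : f.T z = (f.fst z.1, f.snd z.2) := rfl

theorem nonempty_equiv_T (e : X.Iso Y) : Nonempty (X.T.Equiv Y.T) :=
  ⟨IntertwiningMap.ofBijective e.toHom.T (e.fst.prodCongr e.snd).bijective⟩

theorem isIndecomposable_of_T (hX : X.T.IsIndecomposable) : X.IsIndecomposable := by
  refine ⟨hX.1, fun f hf => ?_⟩
  have hf₁ (v : V) : f.fst (f.fst v) = f.fst v := congr(($hf).fst v)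
  have hf₂ (w : W) : f.snd (f.snd w) = f.snd w := congr(($hf).snd w)
  refine ((isIndecomposable_iff_forall_idempotent.1 hX).2 f.T ?_).imp (fun h => ?_) fun h => ?_
  · ext z <;> simp [Hom.T_apply, hf₁, hf₂]
  · ext v
    exacts [congr(($h (v, 0)).1), congr(($h (0, v)).2)]
  · ext v
    exacts [congr(($h (v, 0)).1), congr(($h (0, v)).2)]

theorem apply_inr_α₁ (f : X.T.IntertwiningMap Y.T) (v : V) :
    f (0, X.α₁ v) = (0, Y.α₁ (f (v, 0)).1) := by
  have h : f (v, X.α₁ v) = Y.T g₁ (f (v, 0)) := by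
    rw [← f.isIntertwining, T_g₁_apply, zero_add]
  calc f (0, X.α₁ v) = f (v, X.α₁ v) - f (v, 0) := by rw [← map_sub]; simp
    _ = (0, Y.α₁ (f (v, 0)).1) := by rw [h, T_g₁_apply]; ext <;> simp

theorem apply_inr_α₂ (f : X.T.IntertwiningMap Y.T) (v : V) :
    f (0, X.α₂ v) = (0, Y.α₂ (f (v, 0)).1) := by
  have h : f (v, X.α₂ v) = Y.T g₂ (f (v, 0)) := by
    rw [← f.isIntertwining, T_g₂_apply, zero_add]
  calc f (0, X.α₂ v) = f (v, X.α₂ v) - f (v, 0) := by rw [← map_sub]; simp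
    _ = (0, Y.α₂ (f (v, 0)).1) := by rw [h, T_g₂_apply]; ext <;> simp

/-- The morphism formed by the diagonal blocks of a homomorphism `TX → TY`. -/
@[simps]
def Hom.ofT (f : X.T.IntertwiningMap Y.T) : X.Hom Y where
  fst := .fst k V' W' ∘ₗ f.toLinearMap ∘ₗ .inl k V W
  snd := .snd k V' W' ∘ₗ f.toLinearMap ∘ₗ .inr k V W
  snd_α₁ v := congr(($(apply_inr_α₁ f v)).2)
  snd_α₂ v := congr(($(apply_inr_α₂ f v)).2)

theorem IsJointlySurjective.apply_inr (hX : X.IsJointlySurjective) (f : X.T.IntertwiningMap Y.T)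
    (w : W) : f (0, w) = (0, (Hom.ofT f).snd w) := by
  obtain ⟨_, ⟨v, rfl⟩, _, ⟨v', rfl⟩, rfl⟩ :=
    Submodule.mem_sup.1 (hX.ge (Submodule.mem_top (x := w)))
  refine Prod.ext ?_ rfl
  calc (f (0, X.α₁ v + X.α₂ v')).1 = (f (0, X.α₁ v)).1 + (f (0, X.α₂ v')).1 := by
        rw [← Prod.fst_add, ← map_add, Prod.mk_add_mk, zero_add]
    _ = 0 := by rw [apply_inr_α₁, apply_inr_α₂, add_zero]

theorem IsJointlySurjective.ofT_comp (hY : Y.IsJointlySurjective) (g : Y.T.IntertwiningMap Z.T)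
    (f : X.T.IntertwiningMap Y.T) (hX : X.IsJointlySurjective) :
    Hom.ofT (g.comp f) = (Hom.ofT g).comp (Hom.ofT f) := by
  ext z
  · have h : f (z, 0) = ((f (z, 0)).1, 0) + (0, (f (z, 0)).2) := by simp
    change (g (f (z, 0))).1 = (g ((f (z, 0)).1, 0)).1
    rw [h, map_add, hY.apply_inr]
    simp
  · change (g (f (0, z))).2 = (g (0, (f (0, z)).2)).2
    rw [hX.apply_inr]

theorem IsJointlySurjective.nonempty_iso_of_equiv_T (hX : X.IsJointlySurjective)
    (hY : Y.IsJointlySurjective) (e : X.T.Equiv Y.T) : Nonempty (X.Iso Y) := by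
  have h : (Hom.ofT e.symm.toIntertwiningMap).comp (Hom.ofT e.toIntertwiningMap) = .id X := by
    rw [← hY.ofT_comp _ _ hX]
    ext v
    exacts [congr(($(e.symm_apply_apply (v, 0))).1), congr(($(e.symm_apply_apply (0, v))).2)]
  have h' : (Hom.ofT e.toIntertwiningMap).comp (Hom.ofT e.symm.toIntertwiningMap) = .id Y := by
    rw [← hX.ofT_comp _ _ hY]
    ext v
    exacts [congr(($(e.apply_symm_apply (v, 0))).1), congr(($(e.apply_symm_apply (0, v))).2)]
  exact ⟨(Hom.ofT e.toIntertwiningMap).toIso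
    (Function.bijective_iff_has_inverse.2
      ⟨(Hom.ofT e.symm.toIntertwiningMap).fst, fun v => congr(($h).fst v),
        fun v => congr(($h').fst v)⟩)
    (Function.bijective_iff_has_inverse.2
      ⟨(Hom.ofT e.symm.toIntertwiningMap).snd, fun w => congr(($h).snd w),
        fun w => congr(($h').snd w)⟩)⟩

theorem IsIndecomposable.isIndecomposable_T (hX : X.IsIndecomposable)
    (hsurj : X.IsJointlySurjective) : X.T.IsIndecomposable := by
  refine isIndecomposable_iff_forall_idempotent.2 ⟨hX.1, fun p hp => ?_⟩
  have hpp (z : V × W) : p (p z) = p z := congr($hp z)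
  refine (hX.2 (Hom.ofT p) (by rw [← hsurj.ofT_comp _ _ hsurj, hp])).imp (fun h => ?_) fun h => ?_
  · have hv (v : V) : p (v, 0) = (0, (p (v, 0)).2) := Prod.ext congr(($h).fst v) rfl
    have hw (w : W) : p (0, w) = 0 := (hsurj.apply_inr p w).trans congr((0, ($h).snd w))
    have hv (v : V) : p (v, 0) = 0 := by rw [← hpp, hv, hw]
    exact IntertwiningMap.ext (LinearMap.prod_ext (LinearMap.ext hv) (LinearMap.ext hw))
  · have hv (v : V) : p (v, 0) = (v, (p (v, 0)).2) := Prod.ext congr(($h).fst v) rfl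
    have hw (w : W) : p (0, w) = (0, w) := (hsurj.apply_inr p w).trans congr((0, ($h).snd w))
    have hv (v : V) : p (v, 0) = (v, 0) := by
      have h₀ : p (v, 0) + (0, (p (v, 0)).2) = p (v, 0) := by
        calc p (v, 0) + (0, (p (v, 0)).2) = p (v, (p (v, 0)).2) := by
              rw [← hw, ← map_add, Prod.mk_add_mk, add_zero, zero_add]
          _ = p (v, 0) := by rw [← hv, hpp]
      rw [hv, congr(($(add_eq_left.1 h₀)).2), Prod.snd_zero]
    exact IntertwiningMap.ext (LinearMap.prod_ext (LinearMap.ext hv) (LinearMap.ext hw))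

end Functor

open KleinFour Representation

theorem exists_equiv_T {k V : Type*} [Field k] [CharP k 2] [AddCommGroup V] [Module k V]
    {ρ : Representation k KleinFour V} (hρ : ρ.norm = 0) :
    ∃ (M N : Submodule k V) (X : KroneckerRep k M N), Nonempty (ρ.Equiv X.T) := by
  have hA : (ρ g₁ - 1) * (ρ g₁ - 1) = 0 := sub_one_mul_self (by decide)
  have hB : (ρ g₂ - 1) * (ρ g₂ - 1) = 0 := sub_one_mul_self (by decide)
  have hAB : (ρ g₁ - 1) * (ρ g₂ - 1) = 0 := norm_eq.symm.trans hρ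
  have hBA : (ρ g₂ - 1) * (ρ g₁ - 1) = 0 := commute_sub_one.eq.symm.trans hAB
  set A := ρ g₁ - 1 with hA_def
  set B := ρ g₂ - 1 with hB_def
  have h₁ (v : V) : ρ g₁ v = v + A v := by simp [hA_def]
  have h₂ (v : V) : ρ g₂ v = v + B v := by simp [hB_def]
  let N := A.range ⊔ B.range
  have hAN (n : N) : A n = 0 :=
    (sup_le (LinearMap.range_le_ker_iff.2 hA) (LinearMap.range_le_ker_iff.2 hAB) : N ≤ A.ker) n.2
  have hBN (n : N) : B n = 0 :=
    (sup_le (LinearMap.range_le_ker_iff.2 hBA) (LinearMap.range_le_ker_iff.2 hB) : N ≤ B.ker) n.2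
  obtain ⟨M, hMN⟩ := Submodule.exists_isCompl N
  let X : KroneckerRep k M N :=
    { α₁ := (A ∘ₗ M.subtype).codRestrict N fun m => Submodule.mem_sup_left ⟨m, rfl⟩
      α₂ := (B ∘ₗ M.subtype).codRestrict N fun m => Submodule.mem_sup_right ⟨m, rfl⟩ }
  let e := Submodule.prodEquivOfIsCompl M N hMN.symm
  have he (z : M × N) : e z = z.1 + z.2 := Submodule.coe_prodEquivOfIsCompl' M N hMN.symm z
  let f : X.T.IntertwiningMap ρ := intertwiningMap e.toLinearMap
    (fun z => by simp [he, h₁, hAN, X]; abel) (fun z => by simp [he, h₂, hBN, X]; abel)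
  exact ⟨M, N, X, ⟨(IntertwiningMap.ofBijective f e.bijective).symm⟩⟩

end KroneckerRep

section DegeneracyPoint

variable {k V : Type*} [Field k] [AddCommGroup V] [Module k V]

theorem injective_smul_one_add_iff_of_isNilpotent [Nontrivial V] {N : Module.End k V}
    (hN : IsNilpotent N) (a : k) : Function.Injective (a • (1 : Module.End k V) + N) ↔ a ≠ 0 := by
  refine ⟨fun h ha => ?_, fun ha => ?_⟩
  · obtain ⟨x, -, hx0, hx⟩ :=
      exists_mem_ker_of_isNilpotent hN (U := ⊤) (fun _ _ => trivial) top_ne_bot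
    exact hx0 (h (by simp [ha, hx]))
  · have hunit : IsUnit (a • (1 : Module.End k V)) := (isUnit_one.smul (Units.mk0 a ha))
    exact ((Module.End.isUnit_iff _).1
      (hN.isUnit_add_left_of_commute hunit ((Commute.one_right N).smul_right a))).1

theorem eq_of_rep_mul_eq_rep_mul {l l' : Projectivization k (Fin 2 → k)}
    (h : l.rep 0 * l'.rep 1 = l.rep 1 * l'.rep 0) : l = l' := by
  by_contra hne
  have hind := Projectivization.independent_iff.1
    ((Projectivization.independent_pair_iff_ne l l').2 hne)
  have hdet := (Matrix.isUnit_iff_isUnit_det _).1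
    (Matrix.linearIndependent_rows_iff_isUnit (A := Projectivization.rep ∘ ![l, l']).1 hind)
  exact hdet.ne_zero ((Matrix.det_fin_two _).trans (sub_eq_zero.2 h))

end DegeneracyPoint

namespace KroneckerRep

variable {k V W V' W' : Type*} [Field k] [AddCommGroup V] [Module k V] [AddCommGroup W]
  [Module k W] [AddCommGroup V'] [Module k V'] [AddCommGroup W'] [Module k W']

theorem Iso.injective_pencil_iff {X : KroneckerRep k V W} {Y : KroneckerRep k V' W'} (e : X.Iso Y)
    (c d : k) : Function.Injective (c • X.α₁ + d • X.α₂) ↔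
      Function.Injective (c • Y.α₁ + d • Y.α₂) := by
  have h : e.snd ∘ (c • X.α₁ + d • X.α₂) = (c • Y.α₁ + d • Y.α₂) ∘ e.fst := by
    ext v
    simp [e.snd_α₁, e.snd_α₂]
  rw [← EquivLike.comp_injective _ e.snd, h, EquivLike.injective_comp]

theorem injective_pencil_R_iff (q : ℕ) (l : Projectivization k (Fin 2 → k)) (c d : k) :
    Function.Injective (c • (R (q + 1) l).α₁ + d • (R (q + 1) l).α₂) ↔
      c * l.rep 0 + d * l.rep 1 ≠ 0 := by
  have hJ (b : k) : IsNilpotent (b • (jordanBlock (q + 1) (0 : k)).toLin') :=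
    isNilpotent_toLin'_jordanBlock_zero.smul b
  rw [R]
  split_ifs with h
  · have h₀ : l.rep 0 ≠ 0 := fun h₀ => l.rep_nonzero (by ext i; fin_cases i <;> assumption)
    refine (injective_smul_one_add_iff_of_isNilpotent (hJ d) c).trans ?_
    simp [h, h₀]
  · have hsum : c • (jordanBlock (q + 1) (l.rep 0 / l.rep 1)).toLin' + d • LinearMap.id =
        (c * (l.rep 0 / l.rep 1) + d) • (1 : Module.End k (Fin (q + 1) → k)) +
          c • (jordanBlock (q + 1) 0).toLin' := by
      rw [toLin'_jordanBlock, Algebra.algebraMap_eq_smul_one, ← Module.End.one_eq_id]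
      module
    rw [hsum, injective_smul_one_add_iff_of_isNilpotent (hJ c), ← mul_ne_zero_iff_right h, add_mul,
      mul_assoc, div_mul_cancel₀ _ h]

theorem eq_of_iso_R {q : ℕ} {l l' : Projectivization k (Fin 2 → k)}
    (e : (R (q + 1) l).Iso (R (q + 1) l')) : l = l' := by
  have h := e.injective_pencil_iff (l'.rep 1) (-l'.rep 0)
  rw [injective_pencil_R_iff, injective_pencil_R_iff, not_iff_not] at h
  exact eq_of_rep_mul_eq_rep_mul (by linear_combination h.2 (by ring))

open KleinFour Representation

variable {k : Type*} [Field k]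

theorem isEmpty_iso_P_I (r : ℕ) : IsEmpty ((P k r).Iso (I k r)) :=
  ⟨fun e => by simpa using e.fst.finrank_eq⟩

variable [CharP k 2]

theorem nonempty_equiv_T_P_zero_T_I_zero : Nonempty ((P k 0).T.Equiv (I k 0).T) := by
  have hP : (P k 0).α₁ = 0 ∧ (P k 0).α₂ = 0 := ⟨Subsingleton.elim _ _, Subsingleton.elim _ _⟩
  have hI : (I k 0).α₁ = 0 ∧ (I k 0).α₂ = 0 := ⟨Subsingleton.elim _ _, Subsingleton.elim _ _⟩
  let e := LinearEquiv.prodComm k (Fin 0 → k) (Fin 1 → k)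
  exact ⟨IntertwiningMap.ofBijective
    (intertwiningMap e.toLinearMap (by simp [e, hP, hI]) (by simp [e, hP, hI])) e.bijective⟩

theorem isEmpty_leftRegular_equiv_T {V W : Type*} [AddCommGroup V] [Module k V] [AddCommGroup W]
    [Module k W] (X : KroneckerRep k V W) : IsEmpty ((leftRegular k KleinFour).Equiv X.T) := by
  refine ⟨fun e => leftRegular_norm_single_ne_zero (k := k) (G := KleinFour)
    (e.toLinearEquiv.injective ?_)⟩
  refine (map_norm e.toIntertwiningMap _).trans ?_
  rw [norm_T]
  exact (map_zero e.toLinearEquiv).symm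

end KroneckerRep

section Classification

open KroneckerRep KleinFour Representation

variable {k : Type*} [Field k] [CharP k 2]

theorem finiteDimensional_kleinRep (i : KleinIndex k) : FiniteDimensional k (kleinRep i).V := by
  cases i with
  | regular => exact inferInstanceAs (FiniteDimensional k (MonoidAlgebra k KleinFour))
  | preprojective r _ =>
    exact inferInstanceAs (FiniteDimensional k ((Fin r → k) × (Fin (r + 1) → k)))
  | preinjective r =>
    exact inferInstanceAs (FiniteDimensional k ((Fin (r + 1) → k) × (Fin r → k)))
  | tube p _ _ => exact inferInstanceAs (FiniteDimensional k ((Fin p → k) × (Fin p → k)))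

theorem isIndecomposable_kleinRep (i : KleinIndex k) : (kleinRep i).ρ.IsIndecomposable := by
  cases i with
  | regular => exact isIndecomposable_leftRegular isPGroup_two
  | preprojective r hr =>
    obtain ⟨m, rfl⟩ := Nat.exists_eq_add_of_le' hr
    exact (isIndecomposable_P _).isIndecomposable_T (isIndecomposable_P _).isJointlySurjective
  | preinjective r =>
    exact isIndecomposable_I.isIndecomposable_T isIndecomposable_I.isJointlySurjective
  | tube p hp l =>
    obtain ⟨q, rfl⟩ := Nat.exists_eq_add_of_le' hp
    exact (isIndecomposable_R q l).isIndecomposable_T (isIndecomposable_R q l).isJointlySurjective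

theorem exists_kleinIndex [IsAlgClosed k] {V : Type*} [AddCommGroup V] [Module k V]
    [FiniteDimensional k V] {ρ : Representation k KleinFour V} (hρ : ρ.IsIndecomposable) :
    ∃ i : KleinIndex k, Nonempty (ρ.Equiv (kleinRep i).ρ) := by
  by_cases hnorm : ρ.norm = 0
  · obtain ⟨M, N, X, ⟨e⟩⟩ := exists_equiv_T hnorm
    have hX := isIndecomposable_of_T (isIndecomposable_of_equiv e hρ)
    rcases hX.exists_iso_P_or_I_or_R with ⟨_ | r, ⟨f⟩⟩ | ⟨r, ⟨f⟩⟩ | ⟨q, l, ⟨f⟩⟩ <;>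
      obtain ⟨e'⟩ := nonempty_equiv_T f
    · obtain ⟨e''⟩ := nonempty_equiv_T_P_zero_T_I_zero (k := k)
      exact ⟨.preinjective 0, ⟨(e.trans e').trans e''⟩⟩
    · exact ⟨.preprojective (r + 1) (Nat.succ_pos r), ⟨e.trans e'⟩⟩
    · exact ⟨.preinjective r, ⟨e.trans e'⟩⟩
    · exact ⟨.tube (q + 1) (Nat.succ_pos q) l, ⟨e.trans e'⟩⟩
  · exact ⟨.regular, nonempty_equiv_leftRegular isPGroup_two hρ hnorm⟩

/-- The dimensions of the representations in the list. -/
def KleinIndex.dim : KleinIndex k → ℕ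
  | .regular => 4
  | .preprojective r _ => 2 * r + 1
  | .preinjective r => 2 * r + 1
  | .tube p _ _ => 2 * p

theorem finrank_kleinRep (i : KleinIndex k) : Module.finrank k (kleinRep i).V = i.dim := by
  cases i with
  | regular =>
    change Module.finrank k (MonoidAlgebra k KleinFour) = 4
    rw [(MonoidAlgebra.coeffLinearEquiv k).finrank_eq]
    simp
  | preprojective r hr =>
    change Module.finrank k ((Fin r → k) × (Fin (r + 1) → k)) = 2 * r + 1
    rw [Module.finrank_prod, Module.finrank_fin_fun, Module.finrank_fin_fun]
    ring
  | preinjective r =>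
    change Module.finrank k ((Fin (r + 1) → k) × (Fin r → k)) = 2 * r + 1
    rw [Module.finrank_prod, Module.finrank_fin_fun, Module.finrank_fin_fun]
    ring
  | tube p hp l =>
    change Module.finrank k ((Fin p → k) × (Fin p → k)) = 2 * p
    rw [Module.finrank_prod, Module.finrank_fin_fun, two_mul]

theorem isEmpty_equiv_T_P_T_I {r : ℕ} (hr : 1 ≤ r) : IsEmpty ((P k r).T.Equiv (I k r).T) := by
  obtain ⟨m, rfl⟩ := Nat.exists_eq_add_of_le' hr
  refine ⟨fun e => ?_⟩
  obtain ⟨f⟩ := (isIndecomposable_P (k := k) (m + 1)).isJointlySurjective.nonempty_iso_of_equiv_T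
    isIndecomposable_I.isJointlySurjective e
  exact (isEmpty_iso_P_I _).elim f

theorem eq_of_equiv_T_R {p : ℕ} (hp : 1 ≤ p) {l l' : Projectivization k (Fin 2 → k)}
    (e : (R p l).T.Equiv (R p l').T) : l = l' := by
  obtain ⟨q, rfl⟩ := Nat.exists_eq_add_of_le' hp
  obtain ⟨f⟩ := (isIndecomposable_R q l).isJointlySurjective.nonempty_iso_of_equiv_T
    (isIndecomposable_R q l').isJointlySurjective e
  exact eq_of_iso_R f

theorem eq_of_kleinRep_equiv {i j : KleinIndex k} (e : (kleinRep i).ρ.Equiv (kleinRep j).ρ) :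
    i = j := by
  have hdim : i.dim = j.dim := by
    rw [← finrank_kleinRep, ← finrank_kleinRep]
    exact e.toLinearEquiv.finrank_eq
  rcases i with _ | ⟨r, hr⟩ | r | ⟨p, hp, l⟩ <;>
    rcases j with _ | ⟨r', hr'⟩ | r' | ⟨p', hp', l'⟩ <;>
    simp only [KleinIndex.dim] at hdim <;> try omega
  · rfl
  · exact (isEmpty_leftRegular_equiv_T _).elim e
  · obtain rfl : r = r' := by omega
    rfl
  · obtain rfl : r = r' := by omega
    exact (isEmpty_equiv_T_P_T_I hr).elim e
  · obtain rfl : r = r' := by omega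
    exact (isEmpty_equiv_T_P_T_I hr').elim e.symm
  · obtain rfl : r = r' := by omega
    rfl
  · exact (isEmpty_leftRegular_equiv_T _).elim e.symm
  · obtain rfl : p = p' := by omega
    rw [eq_of_equiv_T_R hp e]

end Classification

theorem mainTheorem7 {k : Type u} [Field k] [IsAlgClosed k] [CharP k 2] :
    -- every representation in the list is finite dimensional and indecomposable
    (∀ i : KleinIndex k,
      FiniteDimensional k (kleinRep i).V ∧ (kleinRep i).ρ.IsIndecomposable) ∧
    -- every finite dimensional indecomposable representation is isomorphic to one in the list
    (∀ (V : Type v) [AddCommGroup V] [Module k V] [FiniteDimensional k V]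
      (ρ : Representation k KleinFour V), ρ.IsIndecomposable →
        ∃ i : KleinIndex k, Nonempty (ρ.Equiv (kleinRep i).ρ)) ∧
    -- the representations in the list are pairwise non-isomorphic
    (∀ i j : KleinIndex k, Nonempty ((kleinRep i).ρ.Equiv (kleinRep j).ρ) → i = j) :=
  ⟨fun i => ⟨finiteDimensional_kleinRep i, isIndecomposable_kleinRep i⟩,
    fun _ _ _ _ _ hρ => exists_kleinIndex hρ, fun _ _ ⟨e⟩ => eq_of_kleinRep_equiv e⟩
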